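/- Conventions. Let $k\ge 1$. A $k$-graph is a countable small category $\Lambda$ with a functor $d:\Lambda\to\mathbb N^k$ such that whenever $d(\lambda)=m+n$ there are unique $\mu,\nu\in\Lambda$ with $\lambda=\mu\nu$, $d(\mu)=m$, $d(\nu)=n$. Elements of $\Lambda$ are called paths, $\Lambda^n=d^{-1}(n)$, the vertices are the elements of $\Lambda^0$, $r$ and $s$ are the range and source maps, $\lambda\mu$ is defined when $s(\lambda)=r(\mu)$, $\Lambda^1=\bigcup_i\Lambda^{e_i}$, and $vE=\{\mu\in E: r(\mu)=v\}$ for $E\subseteq\Lambda$. $\Lambda$ is row-finite if every $v\Lambda^{e_i}$ is finite, and has no sources if $v\Lambda^n\neq\emptyset$ for all $v\in\Lambda^0$, $n\in\mathbb N^k$. Write $\Lambda^{\min}(\lambda,\mu)=\{(\lambda',\mu'):\lambda\lambda'=\mu\mu',\ d(\lambda\lambda')=d(\lambda)\vee d(\mu)\}$. A set $E\subseteq v\Lambda$ is exhaustive if for every $\lambda\in v\Lambda$ there is $\mu\in E$ with $\Lambda^{\min}(\lambda,\mu)\ne\emptyset$. $R$-algebras are associative but need not be unital. For a row-finite $k$-graph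 $\Lambda$, a Cohn $\Lambda$-family in an $R$-algebra consists of elements $T_\lambda,T_{\lambda^*}$ ($\lambda\in\Lambda$), with $T_{v^*}=T_v$ for vertices $v$, such that: the $T_v$ are mutually orthogonal idempotents; $T_\lambda T_\mu=T_{\lambda\mu}$ and $T_{\mu^*}T_{\lambda^*}=T_{(\lambda\mu)^*}$ when $s(\lambda)=r(\mu)$; and $T_{\lambda^*}T_\mu=\sum_{(\nu,\gamma)\in\Lambda^{\min}(\lambda,\mu)}T_\nu T_{\gamma^*}$ for all $\lambda,\mu$. It is a Kumjian–Pask $\Lambda$-family if in addition $\prod_{\lambda\in E}(T_v-T_\lambda T_{\lambda^*})=0$ for every vertex $v$ and every finite exhaustive $E\subseteq v\Lambda$. Let $C_R(\Lambda)$ (Cohn path algebra) and $KP_R(\Lambda)$ (Kumjian–Pask algebra) be the $R$-algebras generated by the universal Cohn family $\{t_\lambda,t_{\mu^*}\}$ and the universal Kumjian–Pask family $\{s_\lambda,s_{\mu^*}\}$, respectively. For a row-finite $k$-graph $\Lambda$ with no sources, $T\Lambda$ is the $k$-graph with vertices $\alpha(v),\beta(v)$ ($v\in\Lambda^0$) and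 paths $\alpha(\lambda),\beta(\lambda)$ ($\lambda\in\Lambda$), where $d(\alpha(\lambda))=d(\beta(\lambda))=d(\lambda)$; for $\lambda\notin\Lambda^0$, $r(\alpha(\lambda))=r(\beta(\lambda))=\alpha(r(\lambda))$, $s(\alpha(\lambda))=\alpha(s(\lambda))$, $s(\beta(\lambda))=\beta(s(\lambda))$; and composition is $\alpha(\lambda)\alpha(\mu)=\alpha(\lambda\mu)$, $\alpha(\lambda)\beta(\mu)=\beta(\lambda\mu)$ for $\mu\notin\Lambda^0$, $\beta(\lambda)\beta(s(\lambda))=\beta(\lambda)$. **Theorem.** Let $k\ge1$, let $\Lambda$ be a row-finite $k$-graph with no sources, and let $R$ be a commutative ring with $1$. For $v\in\Lambda^0$ put $F_{t,v}=t_v-\prod_{e\in v\Lambda^1}(t_v-t_et_{e^*})\in C_R(\Lambda)$. For $\tau,\omega\in T\Lambda$ define $$S_\tau=\begin{cases}t_\lambda F_{t,s(\lambda)}&\text{if }\tau=\alpha(\lambda),\\ t_\lambda\,(t_{s(\lambda)}-F_{t,s(\lambda)})&\text{if }\tau=\beta(\lambda),\end{cases}\qquad S_{\omega^*}=\begin{cases}F_{t,s(\mu)}\,t_{\mu^*}&\text{if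 }\omega=\alpha(\mu),\\ (t_{s(\mu)}-F_{t,s(\mu)})\,t_{\mu^*}&\text{if }\omega=\beta(\mu).\end{cases}$$ (a) There is an $R$-algebra homomorphism $\pi:KP_R(T\Lambda)\to C_R(\Lambda)$ with $\pi(s_\tau)=S_\tau$ and $\pi(s_{\omega^*})=S_{\omega^*}$ for all $\tau,\omega\in T\Lambda$, and $\pi$ is an isomorphism. (b) The subsets $C_R(\Lambda)_n=\operatorname{span}_R\{t_\lambda t_{\mu^*}:\lambda,\mu\in\Lambda,\ d(\lambda)-d(\mu)=n\}$, $n\in\mathbb Z^k$, form a $\mathbb Z^k$-grading of $C_R(\Lambda)$: $C_R(\Lambda)=\bigoplus_{n\in\mathbb Z^k}C_R(\Lambda)_n$ and $C_R(\Lambda)_mC_R(\Lambda)_n\subseteq C_R(\Lambda)_{m+n}$. -/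

import Mathlib

universe u v w

/-! ### Higher-rank graphs -/

/-- A `k`-graph: a countable small category with object set `Vert` and set of morphisms ("paths")
`Path`, together with a functor `d` to `ℕ^k` having the factorisation property. A path `a` goes
from its source `s a` to its range `r a`, and `comp a b` is the composite `ab`, defined when
`s a = r b`. A vertex `x` is identified with the identity path `idn x`; by the factorisation
property the identities are exactly the paths of degree `0`. -/
structure KGraph (k : ℕ) where
  Vert : Type u
  Path : Type v
  countable_path : Countable Path
  r : Path → Vert
  s : Path → Vert
  idn : Vert → Path
  comp : (a b : Path) → s a = r b → Path
  r_idn : ∀ x, r (idn x) = x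
  s_idn : ∀ x, s (idn x) = x
  r_comp : ∀ a b h, r (comp a b h) = r a
  s_comp : ∀ a b h, s (comp a b h) = s b
  idn_comp : ∀ a, comp (idn (r a)) a (s_idn (r a)) = a
  comp_idn : ∀ a, comp a (idn (s a)) (r_idn (s a)).symm = a
  assoc : ∀ a b c (h : s a = r b) (h' : s b = r c),
    comp (comp a b h) c ((s_comp a b h).trans h') =
      comp a (comp b c h') (h.trans (r_comp b c h').symm)
  d : Path → (Fin k → ℕ)
  d_idn : ∀ x, d (idn x) = 0
  d_comp : ∀ a b h, d (comp a b h) = d a + d b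
  factorisation : ∀ a (m n : Fin k → ℕ), d a = m + n →
    ∃! p : Path × Path, d p.1 = m ∧ d p.2 = n ∧ ∃ h : s p.1 = r p.2, comp p.1 p.2 h = a

namespace KGraph

variable {k : ℕ} (Λ : KGraph.{u, v} k)

/-- The set `vΛ^n` of paths of degree `n` with range `x`. -/
def pathsAt (x : Λ.Vert) (n : Fin k → ℕ) : Set Λ.Path := {a | Λ.r a = x ∧ Λ.d a = n}

/-- The set `vΛ^1` of edges (paths of degree some `e_i`) with range `x`. -/
def edgesAt (x : Λ.Vert) : Set Λ.Path := {a | Λ.r a = x ∧ ∃ i, Λ.d a = Pi.single i 1}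

/-- `Λ` is row-finite: `vΛ^{e_i}` is finite for every vertex and every `i`. -/
def RowFinite : Prop := ∀ (x : Λ.Vert) (i : Fin k), (Λ.pathsAt x (Pi.single i 1)).Finite

/-- `Λ` has no sources: `vΛ^n` is nonempty for every vertex and every `n`. -/
def NoSources : Prop := ∀ (x : Λ.Vert) (n : Fin k → ℕ), (Λ.pathsAt x n).Nonempty

/-- `a` is an initial segment of `c`, that is, `c(0, d(a)) = a`. -/
def IsInitial (a c : Λ.Path) : Prop := ∃ (b : Λ.Path) (h : Λ.s a = Λ.r b), Λ.comp a b h = c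

/-- The set of minimal common extensions of `a` and `b`. -/
def MCE (a b : Λ.Path) : Set Λ.Path :=
  {c | Λ.d c = Λ.d a ⊔ Λ.d b ∧ Λ.IsInitial a c ∧ Λ.IsInitial b c}

/-- `Λ^min(a, b)`: the pairs `(a', b')` with `aa' = bb' ∈ MCE(a, b)`. -/
def minExt (a b : Λ.Path) : Set (Λ.Path × Λ.Path) :=
  {p | ∃ (h : Λ.s a = Λ.r p.1) (h' : Λ.s b = Λ.r p.2),
    Λ.comp a p.1 h = Λ.comp b p.2 h' ∧ Λ.comp a p.1 h ∈ Λ.MCE a b}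

/-- `E` is an exhaustive subset of `vΛ`. -/
def IsExhaustive (x : Λ.Vert) (E : Set Λ.Path) : Prop :=
  (∀ b ∈ E, Λ.r b = x) ∧ ∀ a, Λ.r a = x → ∃ b ∈ E, (Λ.minExt a b).Nonempty

variable {Λ}

theorem RowFinite.edgesAt_finite (hΛ : Λ.RowFinite) (x : Λ.Vert) : (Λ.edgesAt x).Finite := by
  refine (Set.finite_iUnion (hΛ x)).subset ?_
  rintro a ⟨h, i, hi⟩
  exact Set.mem_iUnion.2 ⟨i, h, hi⟩

theorem eq_idn_of_d_eq_zero {a : Λ.Path} (h : Λ.d a = 0) : a = Λ.idn (Λ.r a) := by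
  obtain ⟨p, -, hu⟩ := Λ.factorisation a 0 0 (by simp [h])
  have h1 := hu (Λ.idn (Λ.r a), a) ⟨Λ.d_idn _, h, Λ.s_idn _, Λ.idn_comp a⟩
  have h2 := hu (a, Λ.idn (Λ.s a)) ⟨h, Λ.d_idn _, (Λ.r_idn _).symm, Λ.comp_idn a⟩
  exact (congrArg Prod.fst (h2.trans h1.symm))

theorem RowFinite.pathsAt_finite (hΛ : Λ.RowFinite) (x : Λ.Vert) (n : Fin k → ℕ) :
    (Λ.pathsAt x n).Finite := by
  classical
  obtain ⟨N, hN⟩ : ∃ N, ∑ i, n i = N := ⟨_, rfl⟩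
  induction N generalizing x n with
  | zero =>
    have h0 : n = 0 := by
      ext i
      have := (Finset.sum_eq_zero_iff.1 hN) i (Finset.mem_univ i)
      simpa using this
    refine (Set.finite_singleton (Λ.idn x)).subset ?_
    rintro a ⟨hr, hd⟩
    have := eq_idn_of_d_eq_zero (hd.trans h0)
    rw [hr] at this
    exact this
  | succ N ih =>
    obtain ⟨i, hi⟩ : ∃ i, n i ≠ 0 := by
      by_contra! hcon
      simp [hcon] at hN
    set n' : Fin k → ℕ := n - Pi.single i 1 with hn'
    have hle : (Pi.single i 1 : Fin k → ℕ) ≤ n := by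
      intro j
      by_cases hj : j = i
      · subst hj
        simpa using Nat.one_le_iff_ne_zero.2 hi
      · simp [Pi.single_eq_of_ne hj]
    have hsum : n = Pi.single i 1 + n' := (add_tsub_cancel_of_le hle).symm
    have hN' : ∑ j, n' j = N := by
      have h1 : ∑ j, n j = ∑ j, (Pi.single i 1 : Fin k → ℕ) j + ∑ j, n' j := by
        rw [← Finset.sum_add_distrib]
        exact Finset.sum_congr rfl fun j _ => congrFun hsum j
      rw [hN, Finset.sum_pi_single'] at h1
      simp at h1
      omega
    refine ((hΛ x i).biUnion fun e _ => (ih (Λ.s e) n' hN').image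
      fun b => if h : Λ.s e = Λ.r b then Λ.comp e b h else e).subset ?_
    rintro a ⟨hr, hd⟩
    obtain ⟨⟨e, b⟩, ⟨he, hb, h, hc⟩, -⟩ := Λ.factorisation a _ _ (hd.trans hsum)
    refine Set.mem_biUnion (x := e) ⟨?_, he⟩ ⟨b, ⟨h.symm, hb⟩, ?_⟩
    · rw [← hr, ← hc, Λ.r_comp]
    · simp only at h hc ⊢
      rw [dif_pos h, hc]

/-- In a row-finite `k`-graph the sets `Λ^min(a, b)` are finite. -/
theorem RowFinite.minExt_finite (hΛ : Λ.RowFinite) (a b : Λ.Path) : (Λ.minExt a b).Finite := by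
  refine ((hΛ.pathsAt_finite (Λ.s a) (Λ.d a ⊔ Λ.d b - Λ.d a)).prod
    (hΛ.pathsAt_finite (Λ.s b) (Λ.d a ⊔ Λ.d b - Λ.d b))).subset ?_
  rintro ⟨a', b'⟩ ⟨h, h', he, hd, -, -⟩
  have hd' := hd
  rw [he] at hd'
  rw [Λ.d_comp] at hd hd'
  exact ⟨⟨h.symm, by rw [← hd]; simp⟩, ⟨h'.symm, by rw [← hd']; simp⟩⟩

/-! ### The `k`-graph `TΛ` -/

variable (Λ)

open Classical in
/-- The range map of `TΛ`; here `Sum.inl` plays the role of `α` and `Sum.inr` that of `β`, both for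
vertices and for paths. The range of `β(a)` is `α(r(a))`, unless `a` is a vertex, in which case
`β(a)` is itself a vertex. -/
noncomputable def toeplitzR : Λ.Path ⊕ Λ.Path → Λ.Vert ⊕ Λ.Vert
  | Sum.inl a => Sum.inl (Λ.r a)
  | Sum.inr a => if Λ.d a = 0 then Sum.inr (Λ.r a) else Sum.inl (Λ.r a)

/-- The source map of `TΛ`. -/
def toeplitzS : Λ.Path ⊕ Λ.Path → Λ.Vert ⊕ Λ.Vert
  | Sum.inl a => Sum.inl (Λ.s a)
  | Sum.inr a => Sum.inr (Λ.s a)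

/-- The degree map of `TΛ`. -/
def toeplitzD : Λ.Path ⊕ Λ.Path → (Fin k → ℕ)
  | Sum.inl a => Λ.d a
  | Sum.inr a => Λ.d a

variable {Λ}

theorem toeplitz_inl_inl {a b : Λ.Path} (h : Λ.toeplitzS (Sum.inl a) = Λ.toeplitzR (Sum.inl b)) :
    Λ.s a = Λ.r b := Sum.inl.inj h

theorem toeplitz_inl_inr {a b : Λ.Path} (h : Λ.toeplitzS (Sum.inl a) = Λ.toeplitzR (Sum.inr b)) :
    Λ.d b ≠ 0 ∧ Λ.s a = Λ.r b := by
  by_cases hb : Λ.d b = 0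
  · simp [toeplitzS, toeplitzR, hb] at h
  · exact ⟨hb, by simpa [toeplitzS, toeplitzR, hb] using h⟩

theorem toeplitz_inr_inl {a b : Λ.Path} (h : Λ.toeplitzS (Sum.inr a) = Λ.toeplitzR (Sum.inl b)) :
    False := by
  simp [toeplitzS, toeplitzR] at h

theorem toeplitz_inr_inr {a b : Λ.Path} (h : Λ.toeplitzS (Sum.inr a) = Λ.toeplitzR (Sum.inr b)) :
    Λ.d b = 0 ∧ Λ.s a = Λ.r b ∧ b = Λ.idn (Λ.s a) := by
  by_cases hb : Λ.d b = 0
  · have h1 : Λ.s a = Λ.r b := by simpa [toeplitzS, toeplitzR, hb] using h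
    exact ⟨hb, h1, by rw [h1]; exact eq_idn_of_d_eq_zero hb⟩
  · simp [toeplitzS, toeplitzR, hb] at h

variable (Λ)

/-- Composition in `TΛ`: `α(a)α(b) = α(ab)`, `α(a)β(b) = β(ab)` and `β(a)β(s(a)) = β(a)`. -/
def toeplitzComp : (a b : Λ.Path ⊕ Λ.Path) → Λ.toeplitzS a = Λ.toeplitzR b → Λ.Path ⊕ Λ.Path
  | Sum.inl a, Sum.inl b, h => Sum.inl (Λ.comp a b (toeplitz_inl_inl h))
  | Sum.inl a, Sum.inr b, h => Sum.inr (Λ.comp a b (toeplitz_inl_inr h).2)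
  | Sum.inr a, _, _ => Sum.inr a

theorem toeplitzComp_congr {a a' b : Λ.Path ⊕ Λ.Path} (ha : a = a')
    (h : Λ.toeplitzS a = Λ.toeplitzR b) :
    Λ.toeplitzComp a b h = Λ.toeplitzComp a' b (ha ▸ h) := by
  subst ha
  rfl

theorem toeplitz_s_comp (a b : Λ.Path ⊕ Λ.Path) (h : Λ.toeplitzS a = Λ.toeplitzR b) :
    Λ.toeplitzS (Λ.toeplitzComp a b h) = Λ.toeplitzS b := by
  rcases a with a | a <;> rcases b with b | b
  · simp [toeplitzS, toeplitzComp, Λ.s_comp]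
  · simp [toeplitzS, toeplitzComp, Λ.s_comp]
  · exact (toeplitz_inr_inl h).elim
  · obtain ⟨-, -, rfl⟩ := toeplitz_inr_inr h
    simp [toeplitzS, toeplitzComp, Λ.s_idn]

theorem toeplitz_r_comp (a b : Λ.Path ⊕ Λ.Path) (h : Λ.toeplitzS a = Λ.toeplitzR b) :
    Λ.toeplitzR (Λ.toeplitzComp a b h) = Λ.toeplitzR a := by
  rcases a with a | a <;> rcases b with b | b
  · simp [toeplitzR, toeplitzComp, Λ.r_comp]
  · simp [toeplitzR, toeplitzComp, Λ.r_comp, Λ.d_comp, (toeplitz_inl_inr h).1]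
  · rfl
  · rfl

/-- The `k`-graph `TΛ`, with vertices `α(v), β(v)` for `v` a vertex of `Λ` and paths
`α(a), β(a)` for `a` a path of `Λ`. -/
noncomputable def toeplitz : KGraph.{u, v} k where
  Vert := Λ.Vert ⊕ Λ.Vert
  Path := Λ.Path ⊕ Λ.Path
  countable_path := by
    have := Λ.countable_path
    infer_instance
  r := Λ.toeplitzR
  s := Λ.toeplitzS
  idn := Sum.map Λ.idn Λ.idn
  comp := Λ.toeplitzComp
  r_idn := by rintro (x | x) <;> simp [toeplitzR, Λ.r_idn, Λ.d_idn]
  s_idn := by rintro (x | x) <;> simp [toeplitzS, Λ.s_idn]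
  r_comp := Λ.toeplitz_r_comp
  s_comp := Λ.toeplitz_s_comp
  idn_comp := by
    rintro (a | a)
    · exact congrArg Sum.inl (Λ.idn_comp a)
    · by_cases ha : Λ.d a = 0
      · have hh := eq_idn_of_d_eq_zero ha
        rw [Λ.toeplitzComp_congr (a' := Sum.inr (Λ.idn (Λ.r a))) (by simp [toeplitzR, ha])]
        exact congrArg Sum.inr hh.symm
      · rw [Λ.toeplitzComp_congr (a' := Sum.inl (Λ.idn (Λ.r a))) (by simp [toeplitzR, ha])]
        exact congrArg Sum.inr (Λ.idn_comp a)
  comp_idn := by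
    rintro (a | a)
    · exact congrArg Sum.inl (Λ.comp_idn a)
    · rfl
  assoc := by
    rintro (a | a) (b | b) (c | c) h h'
    · exact congrArg Sum.inl (Λ.assoc _ _ _ _ _)
    · exact congrArg Sum.inr (Λ.assoc _ _ _ _ _)
    all_goals rfl
  d := Λ.toeplitzD
  d_idn := by rintro (x | x) <;> exact Λ.d_idn x
  d_comp := by
    rintro (a | a) (b | b) h
    · exact Λ.d_comp _ _ _
    · exact Λ.d_comp _ _ _
    · exact (toeplitz_inr_inl h).elim
    · simp [toeplitzD, toeplitzComp, (toeplitz_inr_inr h).1]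
  factorisation := by
    rintro (a | a) m n had
    · obtain ⟨⟨p, q⟩, ⟨hp, hq, h, hc⟩, hu⟩ := Λ.factorisation a m n had
      refine ⟨(Sum.inl p, Sum.inl q), ⟨hp, hq, congrArg Sum.inl h, congrArg Sum.inl hc⟩, ?_⟩
      rintro ⟨p' | p', q' | q'⟩ ⟨hp', hq', h', hc'⟩
      · have := hu (p', q') ⟨hp', hq', toeplitz_inl_inl h', Sum.inl.inj hc'⟩
        simp only [Prod.mk.injEq] at this
        simp [this.1, this.2]
      all_goals simp [toeplitzComp] at hc'
    · by_cases hn : n = 0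
      · subst hn
        have ham : Λ.d a = m := by simpa [toeplitzD] using had
        refine ⟨(Sum.inr a, Sum.inr (Λ.idn (Λ.s a))),
          ⟨ham, Λ.d_idn _, by simp [toeplitzS, toeplitzR, Λ.d_idn, Λ.r_idn], rfl⟩, ?_⟩
        rintro ⟨p' | p', q' | q'⟩ ⟨hp', hq', h', hc'⟩
        · simp [toeplitzComp] at hc'
        · exact ((toeplitz_inl_inr h').1 hq').elim
        · exact (toeplitz_inr_inl h').elim
        · obtain ⟨-, -, rfl⟩ := toeplitz_inr_inr h'
          obtain rfl : p' = a := Sum.inr.inj hc'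
          rfl
      · obtain ⟨⟨p, q⟩, ⟨hp, hq, h, hc⟩, hu⟩ := Λ.factorisation a m n had
        simp only at hp hq h hc
        refine ⟨(Sum.inl p, Sum.inr q), ⟨hp, hq, ?_, congrArg Sum.inr hc⟩, ?_⟩
        · simp [toeplitzS, toeplitzR, hq, hn, h]
        rintro ⟨p' | p', q' | q'⟩ ⟨hp', hq', h', hc'⟩
        · simp [toeplitzComp] at hc'
        · have := hu (p', q') ⟨hp', hq', (toeplitz_inl_inr h').2, Sum.inr.inj hc'⟩
          simp only [Prod.mk.injEq] at this
          simp [this.1, this.2]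
        · exact (toeplitz_inr_inl h').elim
        · exact (hn (hq'.symm.trans (toeplitz_inr_inr h').1)).elim

/-- If `Λ` is row-finite then so is `TΛ`. -/
theorem RowFinite.toeplitz {Λ : KGraph.{u, v} k} (hΛ : Λ.RowFinite) : Λ.toeplitz.RowFinite := by
  have key : ∀ x i, ((Sum.inl '' Λ.pathsAt x (Pi.single i 1)) ∪
      (Sum.inr '' Λ.pathsAt x (Pi.single i 1)) : Set (Λ.Path ⊕ Λ.Path)).Finite := fun x i =>
    ((hΛ x i).image _).union ((hΛ x i).image _)
  intro x i
  refine (key (x.elim id id) i).subset ?_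
  rintro (a | a) ⟨hr, hd⟩
  · refine Or.inl ⟨a, ⟨?_, hd⟩, rfl⟩
    rw [← hr]
    rfl
  · refine Or.inr ⟨a, ⟨?_, hd⟩, rfl⟩
    rw [← hr]
    by_cases ha : Λ.d a = 0 <;> simp [KGraph.toeplitz, toeplitzR, ha]

/-! ### Cohn families and Kumjian–Pask families -/

section Families

variable {A : Type w} [NonUnitalRing A]

/-- The product `∏_{a ∈ l} (T_v - T_a T_{a*})`, taken in the order of the list `l`, the empty
product being `T_v`. When `T` is a Cohn family and the entries of `l` have range `v`, the element
`T_v` is an identity for the factors, and the factors commute, so the order is immaterial (see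
`IsCohnFamily.gapProd_perm`). -/
def gapProd (T Tstar : Λ.Path → A) (x : Λ.Vert) (l : List Λ.Path) : A :=
  l.foldr (fun a y => (T (Λ.idn x) - T a * Tstar a) * y) (T (Λ.idn x))

/-- `{T_a, T_{b*}}` is a Cohn `Λ`-family in `A`. The family is given by the two maps `a ↦ T_a` and
`b ↦ T_{b*}` on paths, which agree on vertices since `v* = v`. -/
structure IsCohnFamily (T Tstar : Λ.Path → A) : Prop where
  ghost_idn : ∀ x, Tstar (Λ.idn x) = T (Λ.idn x)
  idem : ∀ x, T (Λ.idn x) * T (Λ.idn x) = T (Λ.idn x)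
  orth : ∀ x y, x ≠ y → T (Λ.idn x) * T (Λ.idn y) = 0
  mul_path : ∀ a b (h : Λ.s a = Λ.r b), T a * T b = T (Λ.comp a b h)
  mul_ghost : ∀ a b (h : Λ.s a = Λ.r b), Tstar b * Tstar a = Tstar (Λ.comp a b h)
  ghost_mul_path : ∀ a b, Tstar a * T b = ∑ᶠ p ∈ Λ.minExt a b, T p.1 * Tstar p.2

/-- `{T_a, T_{b*}}` is a Kumjian–Pask `Λ`-family in `A`: in addition to the relations of a Cohn
family, `∏_{a ∈ E} (T_v - T_a T_{a*}) = 0` for every vertex `v` and finite exhaustive `E ⊆ vΛ`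
(for every enumeration of `E`). -/
structure IsKPFamily (T Tstar : Λ.Path → A) : Prop extends IsCohnFamily Λ T Tstar where
  gap_eq_zero : ∀ x (l : List Λ.Path), l.Nodup → Λ.IsExhaustive x {a | a ∈ l} →
    gapProd Λ T Tstar x l = 0

variable {Λ}

/-- `F_{T,v} = T_v - ∏_{e ∈ vΛ^1} (T_v - T_e T_{e*})`, for row-finite `Λ`. -/
noncomputable def vertexRange (hΛ : Λ.RowFinite) (T Tstar : Λ.Path → A) (x : Λ.Vert) : A :=
  T (Λ.idn x) - gapProd Λ T Tstar x (hΛ.edgesAt_finite x).toFinset.toList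

/-- The elements `S_τ`, `τ ∈ TΛ`: `S_{α(a)} = T_a F_{T,s(a)}` and
`S_{β(a)} = T_a (T_{s(a)} - F_{T,s(a)})`. -/
noncomputable def toeplitzPath (hΛ : Λ.RowFinite) (T Tstar : Λ.Path → A) :
    Λ.toeplitz.Path → A
  | Sum.inl a => T a * vertexRange hΛ T Tstar (Λ.s a)
  | Sum.inr a => T a * (T (Λ.idn (Λ.s a)) - vertexRange hΛ T Tstar (Λ.s a))

/-- The elements `S_{ω*}`, `ω ∈ TΛ`: `S_{α(b)*} = F_{T,s(b)} T_{b*}` and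
`S_{β(b)*} = (T_{s(b)} - F_{T,s(b)}) T_{b*}`. -/
noncomputable def toeplitzGhost (hΛ : Λ.RowFinite) (T Tstar : Λ.Path → A) :
    Λ.toeplitz.Path → A
  | Sum.inl b => vertexRange hΛ T Tstar (Λ.s b) * Tstar b
  | Sum.inr b => (T (Λ.idn (Λ.s b)) - vertexRange hΛ T Tstar (Λ.s b)) * Tstar b

theorem IsCohnFamily.proj_comm (hΛ : Λ.RowFinite) {T Tstar : Λ.Path → A}
    (hT : IsCohnFamily Λ T Tstar) (a b : Λ.Path) :
    (T a * Tstar a) * (T b * Tstar b) = (T b * Tstar b) * (T a * Tstar a) := by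
  have key : ∀ a b, (T a * Tstar a) * (T b * Tstar b) =
      ∑ᶠ p ∈ Λ.minExt a b, (T a * T p.1) * (Tstar p.2 * Tstar b) := by
    intro a b
    have h1 : (T a * Tstar a) * (T b * Tstar b) = T a * (Tstar a * T b) * Tstar b := by
      simp only [mul_assoc]
    rw [h1, hT.ghost_mul_path]
    have h2 := ((AddMonoidHom.mulRight (Tstar b)).comp (AddMonoidHom.mulLeft (T a))).map_finsum_mem
      (fun p : Λ.Path × Λ.Path => T p.1 * Tstar p.2) (hΛ.minExt_finite a b)
    simpa [mul_assoc] using h2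
  rw [key a b, key b a]
  refine finsum_mem_eq_of_bijOn Prod.swap ⟨?_, Prod.swap_injective.injOn, ?_⟩ ?_
  · rintro ⟨p, q⟩ ⟨h, h', he, hd, hi, hj⟩
    exact ⟨h', h, he.symm, he ▸ ⟨by rw [hd, sup_comm], hj, hi⟩⟩
  · rintro ⟨q, p⟩ ⟨h', h, he, hd, hj, hi⟩
    exact ⟨(p, q), ⟨h, h', he.symm, he ▸ ⟨by rw [hd, sup_comm], hi, hj⟩⟩, rfl⟩
  · rintro ⟨p, q⟩ ⟨h, h', he, -⟩
    simp only [Prod.fst_swap, Prod.snd_swap]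
    rw [hT.mul_path a p h, hT.mul_ghost b q h', hT.mul_path b q h', hT.mul_ghost a p h, he]

/-- In a Cohn family the product `∏ (T_v - T_a T_{a*})` does not depend on the order. -/
theorem IsCohnFamily.gapProd_perm (hΛ : Λ.RowFinite) {T Tstar : Λ.Path → A}
    (hT : IsCohnFamily Λ T Tstar) (x : Λ.Vert) {l l' : List Λ.Path} (hl : l.Perm l')
    (hr : ∀ a ∈ l, Λ.r a = x) : gapProd Λ T Tstar x l = gapProd Λ T Tstar x l' := by
  have hleft : ∀ a, Λ.r a = x → T (Λ.idn x) * (T a * Tstar a) = T a * Tstar a := by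
    rintro a rfl
    rw [← mul_assoc, hT.mul_path _ _ (Λ.s_idn _), Λ.idn_comp]
  have hright : ∀ a, Λ.r a = x → T a * Tstar a * T (Λ.idn x) = T a * Tstar a := by
    rintro a rfl
    rw [mul_assoc, ← hT.ghost_idn, hT.mul_ghost _ _ (Λ.s_idn _), Λ.idn_comp]
  induction hl with
  | nil => rfl
  | cons a _ ih =>
    simp only [gapProd, List.foldr_cons] at ih ⊢
    rw [ih fun b hb => hr b (List.mem_cons_of_mem _ hb)]
  | swap a b l =>
    have ha := hr a (by simp)
    have hb := hr b (by simp)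
    simp only [gapProd, List.foldr_cons]
    rw [← mul_assoc, ← mul_assoc]
    congr 1
    simp only [sub_mul, mul_sub, hleft a ha, hleft b hb, hright a ha, hright b hb,
      hT.proj_comm hΛ a b]
    abel
  | trans h1 _ ih1 ih2 =>
    exact (ih1 hr).trans (ih2 fun a ha => hr a (h1.mem_iff.2 ha))

end Families

/-! ### Algebras given by generators and relations (not necessarily unital) -/

section Presentation

variable (R : Type w) [CommRing R]

/-- The free (non-unital) `R`-algebra on the set `X`, with basis the nonempty words in `X`. -/
abbrev FreeAlg (X : Type v) : Type (max v w) := MonoidAlgebra R (FreeSemigroup X)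

/-- The image in the free algebra of a generator. -/
noncomputable def FreeAlg.gen {X : Type v} (x : X) : FreeAlg R X :=
  MonoidAlgebra.single (FreeSemigroup.of x) 1

/-- The smallest congruence on the `R`-algebra `FreeAlg R X` (compatible with addition,
multiplication and scalar multiplication) that contains the relation `rel`. -/
noncomputable def algCon {X : Type v} (rel : FreeAlg R X → FreeAlg R X → Prop) : RingCon (FreeAlg R X) :=
  ringConGen fun a b => ∃ (c : R) (a' b' : FreeAlg R X), rel a' b' ∧ a = c • a' ∧ b = c • b'

theorem algCon_smul {X : Type v} (rel : FreeAlg R X → FreeAlg R X → Prop) (c : R)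
    {a b : FreeAlg R X} (h : algCon R rel a b) : algCon R rel (c • a) (c • b) := by
  have h' : RingConGen.Rel _ a b := h
  induction h' with
  | of a b hab =>
    obtain ⟨e, a', b', hr, rfl, rfl⟩ := hab
    exact RingConGen.Rel.of _ _ ⟨c * e, a', b', hr, by rw [mul_smul], by rw [mul_smul]⟩
  | refl a => exact RingConGen.Rel.refl _
  | symm _ ih => exact RingConGen.Rel.symm (ih ‹_›)
  | trans _ _ ih1 ih2 => exact RingConGen.Rel.trans (ih1 ‹_›) (ih2 ‹_›)
  | add _ _ ih1 ih2 =>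
    rw [smul_add, smul_add]
    exact RingConGen.Rel.add (ih1 ‹_›) (ih2 ‹_›)
  | mul _ h2 ih1 _ =>
    rw [← smul_mul_assoc, ← smul_mul_assoc]
    exact RingConGen.Rel.mul (ih1 ‹_›) h2

/-- The non-unital `R`-algebra with generators `X` and relations `rel`. -/
def PresAlg {X : Type v} (rel : FreeAlg R X → FreeAlg R X → Prop) : Type (max v w) :=
  (algCon R rel).Quotient

namespace PresAlg

variable {X : Type v} (rel : FreeAlg R X → FreeAlg R X → Prop)

noncomputable instance : NonUnitalRing (PresAlg R rel) :=
  inferInstanceAs (NonUnitalRing (algCon R rel).Quotient)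

/-- The quotient map from the free algebra. -/
noncomputable def mk (a : FreeAlg R X) : PresAlg R rel := RingCon.toQuotient (c := algCon R rel) a

theorem mk_surjective : Function.Surjective (mk R rel) := Quotient.mk''_surjective

theorem mk_eq_mk {a b : FreeAlg R X} : mk R rel a = mk R rel b ↔ algCon R rel a b :=
  RingCon.eq _

theorem mk_add (a b : FreeAlg R X) : mk R rel (a + b) = mk R rel a + mk R rel b := rfl

theorem mk_mul (a b : FreeAlg R X) : mk R rel (a * b) = mk R rel a * mk R rel b := rfl

theorem mk_zero : mk R rel 0 = 0 := rfl

noncomputable instance : SMul R (PresAlg R rel) where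
  smul c := Quotient.map' (fun a => c • a) fun _ _ h => algCon_smul R rel c h

theorem mk_smul (c : R) (a : FreeAlg R X) : mk R rel (c • a) = c • mk R rel a := rfl

noncomputable instance : Module R (PresAlg R rel) :=
  Function.Surjective.module R ⟨⟨mk R rel, mk_zero R rel⟩, mk_add R rel⟩ (mk_surjective R rel)
    (mk_smul R rel)

instance : IsScalarTower R (PresAlg R rel) (PresAlg R rel) where
  smul_assoc c a b := by
    obtain ⟨a, rfl⟩ := mk_surjective R rel a
    obtain ⟨b, rfl⟩ := mk_surjective R rel b
    simp only [smul_eq_mul, ← mk_mul, ← mk_smul, smul_mul_assoc]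

instance : SMulCommClass R (PresAlg R rel) (PresAlg R rel) where
  smul_comm c a b := by
    obtain ⟨a, rfl⟩ := mk_surjective R rel a
    obtain ⟨b, rfl⟩ := mk_surjective R rel b
    simp only [smul_eq_mul, ← mk_mul, ← mk_smul, mul_smul_comm]

/-- The quotient map as a homomorphism of non-unital `R`-algebras. -/
noncomputable def mkHom : FreeAlg R X →ₙₐ[R] PresAlg R rel where
  toFun := mk R rel
  map_smul' := mk_smul R rel
  map_zero' := mk_zero R rel
  map_add' := mk_add R rel
  map_mul' := mk_mul R rel

/-- Universal property of `PresAlg R rel`. -/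
theorem existsUnique_lift {A : Type*} [NonUnitalRing A] [Module R A] [IsScalarTower R A A]
    [SMulCommClass R A A] (f : X → A)
    (hf : ∀ φ : FreeAlg R X →ₙₐ[R] A, (∀ x, φ (FreeAlg.gen R x) = f x) →
      ∀ a b, rel a b → φ a = φ b) :
    ∃! π : PresAlg R rel →ₙₐ[R] A, ∀ x, π (mk R rel (FreeAlg.gen R x)) = f x := by
  let φ : FreeAlg R X →ₙₐ[R] A := MonoidAlgebra.liftMagma R (FreeSemigroup.lift f)
  have hφ : ∀ x, φ (FreeAlg.gen R x) = f x := fun x => by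
    simp [φ, FreeAlg.gen, MonoidAlgebra.liftMagma]
  have hrel : ∀ a b, algCon R rel a b → φ a = φ b := by
    intro a b h
    have h' : RingConGen.Rel _ a b := h
    clear h
    induction h' with
    | of a b hab =>
      obtain ⟨c, a', b', hr, rfl, rfl⟩ := hab
      rw [map_smul, map_smul, hf φ hφ _ _ hr]
    | refl a => rfl
    | symm _ ih => exact ih.symm
    | trans _ _ ih1 ih2 => exact ih1.trans ih2
    | add _ _ ih1 ih2 => rw [map_add, map_add, ih1, ih2]
    | mul _ _ ih1 ih2 => rw [map_mul, map_mul, ih1, ih2]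
  let g : PresAlg R rel → A := Quotient.lift (s := (algCon R rel).toSetoid) φ hrel
  have hg : ∀ a, g (mk R rel a) = φ a := fun _ => rfl
  let π : PresAlg R rel →ₙₐ[R] A :=
    { toFun := g
      map_smul' := fun c a => by
        obtain ⟨a, rfl⟩ := mk_surjective R rel a
        rw [← mk_smul, hg, hg, map_smul]
        rfl
      map_zero' := by rw [← mk_zero, hg, map_zero]
      map_add' := fun a b => by
        obtain ⟨a, rfl⟩ := mk_surjective R rel a
        obtain ⟨b, rfl⟩ := mk_surjective R rel b
        rw [← mk_add, hg, hg, hg, map_add]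
      map_mul' := fun a b => by
        obtain ⟨a, rfl⟩ := mk_surjective R rel a
        obtain ⟨b, rfl⟩ := mk_surjective R rel b
        rw [← mk_mul, hg, hg, hg, map_mul] }
  refine ⟨π, hφ, fun π' h' => ?_⟩
  have hcomp : π'.comp (mkHom R rel) = π.comp (mkHom R rel) := by
    refine MonoidAlgebra.nonUnitalAlgHom_ext' R (FreeSemigroup.hom_ext ?_)
    funext x
    exact (h' x).trans (hφ x).symm
  ext a
  obtain ⟨a, rfl⟩ := mk_surjective R rel a
  exact DFunLike.congr_fun hcomp a

end PresAlg

end Presentation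

/-! ### The Cohn path algebra and the Kumjian–Pask algebra -/

section Algebras

variable (R : Type w) [CommRing R]

/-- The generator `a` of the free algebra on paths and ghost paths. -/
noncomputable def genPath (a : Λ.Path) : FreeAlg R (Λ.Path ⊕ Λ.Path) := FreeAlg.gen R (Sum.inl a)

/-- The generator `a*` of the free algebra on paths and ghost paths. -/
noncomputable def genGhost (a : Λ.Path) : FreeAlg R (Λ.Path ⊕ Λ.Path) := FreeAlg.gen R (Sum.inr a)

/-- The defining relations of the Cohn path algebra; the first one is the identification of
`v*` with `v` for vertices `v`. -/
inductive CohnRel : FreeAlg R (Λ.Path ⊕ Λ.Path) → FreeAlg R (Λ.Path ⊕ Λ.Path) → Prop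
  | ghost_idn (x : Λ.Vert) : CohnRel (genGhost Λ R (Λ.idn x)) (genPath Λ R (Λ.idn x))
  | idem (x : Λ.Vert) :
      CohnRel (genPath Λ R (Λ.idn x) * genPath Λ R (Λ.idn x)) (genPath Λ R (Λ.idn x))
  | orth (x y : Λ.Vert) (h : x ≠ y) :
      CohnRel (genPath Λ R (Λ.idn x) * genPath Λ R (Λ.idn y)) 0
  | mul_path (a b : Λ.Path) (h : Λ.s a = Λ.r b) :
      CohnRel (genPath Λ R a * genPath Λ R b) (genPath Λ R (Λ.comp a b h))
  | mul_ghost (a b : Λ.Path) (h : Λ.s a = Λ.r b) :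
      CohnRel (genGhost Λ R b * genGhost Λ R a) (genGhost Λ R (Λ.comp a b h))
  | ghost_mul_path (a b : Λ.Path) :
      CohnRel (genGhost Λ R a * genPath Λ R b)
        (∑ᶠ p ∈ Λ.minExt a b, genPath Λ R p.1 * genGhost Λ R p.2)

/-- The defining relations of the Kumjian–Pask algebra. -/
inductive KPRel : FreeAlg R (Λ.Path ⊕ Λ.Path) → FreeAlg R (Λ.Path ⊕ Λ.Path) → Prop
  | cohn {a b : FreeAlg R (Λ.Path ⊕ Λ.Path)} (h : CohnRel Λ R a b) : KPRel a b
  | gap (x : Λ.Vert) (l : List Λ.Path) (hl : l.Nodup) (hE : Λ.IsExhaustive x {a | a ∈ l}) :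
      KPRel (gapProd Λ (genPath Λ R) (genGhost Λ R) x l) 0

/-- The Cohn path algebra `C_R(Λ)`. -/
abbrev CohnAlg : Type (max v w) := PresAlg R (CohnRel Λ R)

/-- The Kumjian–Pask algebra `KP_R(Λ)`. -/
abbrev KPAlg : Type (max v w) := PresAlg R (KPRel Λ R)

/-- The element `t_a` of the universal Cohn `Λ`-family. -/
noncomputable def CohnAlg.path (a : Λ.Path) : CohnAlg Λ R := PresAlg.mk R _ (genPath Λ R a)

/-- The element `t_{a*}` of the universal Cohn `Λ`-family. -/
noncomputable def CohnAlg.ghost (a : Λ.Path) : CohnAlg Λ R := PresAlg.mk R _ (genGhost Λ R a)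

/-- The element `s_a` of the universal Kumjian–Pask `Λ`-family. -/
noncomputable def KPAlg.path (a : Λ.Path) : KPAlg Λ R := PresAlg.mk R _ (genPath Λ R a)

/-- The element `s_{a*}` of the universal Kumjian–Pask `Λ`-family. -/
noncomputable def KPAlg.ghost (a : Λ.Path) : KPAlg Λ R := PresAlg.mk R _ (genGhost Λ R a)

variable {Λ}

theorem map_gapProd {A : Type*} {B : Type*} [NonUnitalRing A] [NonUnitalRing B] (f : A →ₙ+* B)
    (T Tstar : Λ.Path → A) (x : Λ.Vert) (l : List Λ.Path) :
    f (gapProd Λ T Tstar x l) = gapProd Λ (fun a => f (T a)) (fun a => f (Tstar a)) x l := by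
  induction l with
  | nil => rfl
  | cons a l ih =>
    simp only [gapProd, List.foldr_cons] at ih ⊢
    rw [map_mul, ih, map_sub, map_mul]

theorem isCohnFamily_of_le (hΛ : Λ.RowFinite)
    {rel : FreeAlg R (Λ.Path ⊕ Λ.Path) → FreeAlg R (Λ.Path ⊕ Λ.Path) → Prop}
    (hrel : ∀ a b, CohnRel Λ R a b → rel a b) :
    IsCohnFamily Λ (fun a => PresAlg.mk R rel (genPath Λ R a))
      (fun a => PresAlg.mk R rel (genGhost Λ R a)) := by
  have key : ∀ {a b}, CohnRel Λ R a b → PresAlg.mk R rel a = PresAlg.mk R rel b := fun {a b} h =>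
    (PresAlg.mk_eq_mk R rel).2
      (RingConGen.Rel.of _ _ ⟨1, a, b, hrel _ _ h, (one_smul _ _).symm, (one_smul _ _).symm⟩)
  refine ⟨fun x => key (.ghost_idn x), fun x => key (.idem x), fun x y h => key (.orth x y h),
    fun a b h => key (.mul_path a b h), fun a b h => key (.mul_ghost a b h), fun a b => ?_⟩
  refine (key (.ghost_mul_path a b)).trans ?_
  exact (AddMonoidHomClass.toAddMonoidHom (PresAlg.mkHom R rel)).map_finsum_mem _ (hΛ.minExt_finite a b)

/-- The generators of `C_R(Λ)` form a Cohn `Λ`-family. -/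
theorem CohnAlg.isCohnFamily (hΛ : Λ.RowFinite) :
    IsCohnFamily Λ (CohnAlg.path Λ R) (CohnAlg.ghost Λ R) :=
  isCohnFamily_of_le R hΛ fun _ _ h => h

/-- The generators of `KP_R(Λ)` form a Kumjian–Pask `Λ`-family. -/
theorem KPAlg.isKPFamily (hΛ : Λ.RowFinite) :
    IsKPFamily Λ (KPAlg.path Λ R) (KPAlg.ghost Λ R) := by
  refine ⟨isCohnFamily_of_le R hΛ fun _ _ h => .cohn h, fun x l hl hE => ?_⟩
  refine (map_gapProd (NonUnitalRingHomClass.toNonUnitalRingHom (PresAlg.mkHom R (KPRel Λ R))) (genPath Λ R) (genGhost Λ R)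
    x l).symm.trans ?_
  exact (PresAlg.mk_eq_mk R _).2
    (RingConGen.Rel.of _ _ ⟨1, _, _, .gap x l hl hE, (one_smul _ _).symm, (one_smul _ _).symm⟩)

theorem IsCohnFamily.map_rel (hΛ : Λ.RowFinite) {A : Type*} [NonUnitalRing A]
    {T Tstar : Λ.Path → A} (hT : IsCohnFamily Λ T Tstar)
    (φ : FreeAlg R (Λ.Path ⊕ Λ.Path) →ₙ+* A) (h1 : ∀ a, φ (genPath Λ R a) = T a)
    (h2 : ∀ a, φ (genGhost Λ R a) = Tstar a) {a b : FreeAlg R (Λ.Path ⊕ Λ.Path)}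
    (h : CohnRel Λ R a b) : φ a = φ b := by
  induction h with
  | ghost_idn x => rw [h1, h2, hT.ghost_idn]
  | idem x => rw [map_mul, h1, hT.idem]
  | orth x y h => rw [map_mul, h1, h1, hT.orth x y h, map_zero]
  | mul_path a b h => rw [map_mul, h1, h1, h1, hT.mul_path a b h]
  | mul_ghost a b h => rw [map_mul, h2, h2, h2, hT.mul_ghost a b h]
  | ghost_mul_path a b =>
    rw [map_mul, h1, h2, hT.ghost_mul_path]
    have := (φ : _ →+ A).map_finsum_mem
      (fun p : Λ.Path × Λ.Path => genPath Λ R p.1 * genGhost Λ R p.2) (hΛ.minExt_finite a b)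
    refine Eq.trans ?_ this.symm
    simp [h1, h2]

/-- `C_R(Λ)` is universal for Cohn `Λ`-families. -/
theorem CohnAlg.existsUnique_lift (hΛ : Λ.RowFinite) {A : Type*} [NonUnitalRing A] [Module R A]
    [IsScalarTower R A A] [SMulCommClass R A A] {T Tstar : Λ.Path → A}
    (hT : IsCohnFamily Λ T Tstar) :
    ∃! π : CohnAlg Λ R →ₙₐ[R] A,
      (∀ a, π (CohnAlg.path Λ R a) = T a) ∧ ∀ a, π (CohnAlg.ghost Λ R a) = Tstar a := by
  have := PresAlg.existsUnique_lift R (CohnRel Λ R) (Sum.elim T Tstar) fun φ hφ a b h =>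
    hT.map_rel R hΛ (φ : _ →ₙ+* A) (fun a => hφ (Sum.inl a)) (fun a => hφ (Sum.inr a)) h
  simp only [Sum.forall, Sum.elim_inl, Sum.elim_inr] at this
  exact this

/-- `KP_R(Λ)` is universal for Kumjian–Pask `Λ`-families. -/
theorem KPAlg.existsUnique_lift (hΛ : Λ.RowFinite) {A : Type*} [NonUnitalRing A] [Module R A]
    [IsScalarTower R A A] [SMulCommClass R A A] {T Tstar : Λ.Path → A}
    (hT : IsKPFamily Λ T Tstar) :
    ∃! π : KPAlg Λ R →ₙₐ[R] A,
      (∀ a, π (KPAlg.path Λ R a) = T a) ∧ ∀ a, π (KPAlg.ghost Λ R a) = Tstar a := by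
  have := PresAlg.existsUnique_lift R (KPRel Λ R) (Sum.elim T Tstar) fun φ hφ a b h => by
    have h1 : ∀ a, φ (genPath Λ R a) = T a := fun a => hφ (Sum.inl a)
    have h2 : ∀ a, φ (genGhost Λ R a) = Tstar a := fun a => hφ (Sum.inr a)
    cases h with
    | cohn h => exact hT.toIsCohnFamily.map_rel R hΛ (φ : _ →ₙ+* A) h1 h2 h
    | gap x l hl hE =>
      refine (map_gapProd (φ : _ →ₙ+* A) (genPath Λ R) (genGhost Λ R) x l).trans ?_
      rw [map_zero, ← hT.gap_eq_zero x l hl hE]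
      congr 1
      · exact funext h1
      · exact funext h2
  simp only [Sum.forall, Sum.elim_inl, Sum.elim_inr] at this
  exact this

variable (Λ)

/-- `C_R(Λ)_n`, the span of the elements `t_a t_{b*}` with `d(a) - d(b) = n`. -/
noncomputable def CohnAlg.grade (n : Fin k → ℤ) : Submodule R (CohnAlg Λ R) :=
  Submodule.span R {y | ∃ a b : Λ.Path, (∀ i, (Λ.d a i : ℤ) - (Λ.d b i : ℤ) = n i) ∧
    y = CohnAlg.path Λ R a * CohnAlg.ghost Λ R b}

end Algebras

end KGraph

/-!
The path space representation carries the argument. For every row-finite `k`-graph, the shifts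
`T_a δ_b = δ_{ab}` on the free `R`-module on all finite paths form, with their partial inverses, a
Cohn family (`isCohnFamily_shift`). The algebra `C_R(Λ)` is spanned by the `t_a t_{b*}` with
`s(a) = s(b)`, and the corresponding operators are linearly independent, because
`t_a t_{b*} δ_b = δ_a` while `t_{b*} δ_c = 0` unless `b` is an initial segment of `c`
(`eq_zero_of_sum_shift_backshift_eq_zero`). So the representation is faithful, and the `t_a t_{b*}`
with `s(a) = s(b)` are a basis of `C_R(Λ)`; sorting this basis by degree gives the grading
(`CohnAlg.isInternal_grade`, `CohnAlg.grade_mul`).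

Under the embedding `δ_a ↦ δ_{β(a)}`, the operators `S_τ` become the restriction of the path
representation of `TΛ` to the span of the `δ_{β(a)}`, since in the path representation `F_x` is the
projection onto the paths with range `x` that are not vertices. Hence the `S_τ` satisfy the Cohn
relations. They satisfy the Kumjian–Pask relations as well, since a path `β(a)` has no proper
extension, so that an exhaustive set at its range has to contain one of its initial segments
(`isKPFamily_toeplitz`). This gives `π`.

The inverse of `π` sends `t_a` to `s_{α(a)} + s_{β(a)}`. These elements form a Cohn `Λ`-family
(`IsCohnFamily.of_toeplitz`), as follows from a description of the minimal common extensions in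
`TΛ`. The edges `α(e)`, `β(e)` with range `α(x)` form an exhaustive set, and the corresponding
Kumjian–Pask relation says that the inverse sends `F_{t,x}` to `s_{α(x)}`
(`vertexRange_of_toeplitz`). This is where the absence of sources and `k ≥ 1` enter. The two
composites are then the identity on generators.
-/

namespace KGraph

variable {k : ℕ} {Λ : KGraph.{u, v} k}

/-! ### Factorisation and initial segments -/

theorem comp_inj {a a' b b' : Λ.Path} {h : Λ.s a = Λ.r b} {h' : Λ.s a' = Λ.r b'}
    (hd : Λ.d a = Λ.d a') (he : Λ.comp a b h = Λ.comp a' b' h') : a = a' ∧ b = b' := by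
  have hdeg := congrArg Λ.d he
  rw [Λ.d_comp, Λ.d_comp, hd] at hdeg
  obtain ⟨p, -, hu⟩ := Λ.factorisation (Λ.comp a b h) _ _ (Λ.d_comp a b h)
  have h1 := hu (a, b) ⟨rfl, rfl, h, rfl⟩
  have h2 := hu (a', b') ⟨hd.symm, (add_left_cancel hdeg).symm, h', he.symm⟩
  exact Prod.ext_iff.1 (h1.trans h2.symm)

theorem comp_left_cancel {a b b' : Λ.Path} {h : Λ.s a = Λ.r b} {h' : Λ.s a = Λ.r b'}
    (he : Λ.comp a b h = Λ.comp a b' h') : b = b' :=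
  (comp_inj rfl he).2

theorem exists_comp_of_le {c : Λ.Path} {n : Fin k → ℕ} (hn : n ≤ Λ.d c) :
    ∃ (a b : Λ.Path) (h : Λ.s a = Λ.r b), Λ.d a = n ∧ Λ.comp a b h = c := by
  obtain ⟨⟨a, b⟩, ⟨ha, -, h, hc⟩, -⟩ :=
    Λ.factorisation c n (Λ.d c - n) (add_tsub_cancel_of_le hn).symm
  exact ⟨a, b, h, ha, hc⟩

theorem comp_of_d_eq_zero {a b : Λ.Path} (h : Λ.s a = Λ.r b) (hb : Λ.d b = 0) :
    Λ.comp a b h = a := by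
  obtain rfl : b = Λ.idn (Λ.s a) := by rw [h]; exact eq_idn_of_d_eq_zero hb
  exact Λ.comp_idn a

theorem IsInitial.r_eq {a c : Λ.Path} (h : Λ.IsInitial a c) : Λ.r c = Λ.r a := by
  obtain ⟨b, h, rfl⟩ := h
  exact Λ.r_comp _ _ _

theorem isInitial_idn_iff {x : Λ.Vert} {c : Λ.Path} :
    Λ.IsInitial (Λ.idn x) c ↔ Λ.r c = x := by
  refine ⟨fun h => h.r_eq.trans (Λ.r_idn x), ?_⟩
  rintro rfl
  exact ⟨c, _, Λ.idn_comp c⟩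

/-- Of two initial segments of the same path, the one of smaller degree is an initial segment of
the other. -/
theorem IsInitial.of_le {a b c : Λ.Path} (ha : Λ.IsInitial a c) (hb : Λ.IsInitial b c)
    (hd : Λ.d a ≤ Λ.d b) : Λ.IsInitial a b := by
  obtain ⟨y, hy, rfl⟩ := hb
  obtain ⟨z, hz, he⟩ := ha
  obtain ⟨a', p, h, ha', rfl⟩ := exists_comp_of_le hd
  rw [Λ.assoc a' p y h ((Λ.s_comp _ _ _).symm.trans hy)] at he
  obtain rfl := (comp_inj ha'.symm he).1
  exact ⟨p, h, rfl⟩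

/-- A path of nonzero degree has an edge as an initial segment. -/
theorem exists_edge_isInitial {c : Λ.Path} (hc : Λ.d c ≠ 0) :
    ∃ e ∈ Λ.edgesAt (Λ.r c), Λ.IsInitial e c := by
  obtain ⟨i, hi⟩ : ∃ i, Λ.d c i ≠ 0 := by
    by_contra! hcon
    exact hc (funext hcon)
  have hle : (Pi.single i 1 : Fin k → ℕ) ≤ Λ.d c := by
    intro j
    by_cases hj : j = i
    · subst hj
      simpa using Nat.one_le_iff_ne_zero.2 hi
    · simp [Pi.single_eq_of_ne hj]
  obtain ⟨e, b, h, he, rfl⟩ := exists_comp_of_le hle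
  exact ⟨e, ⟨(Λ.r_comp _ _ _).symm, i, he⟩, b, h, rfl⟩

theorem d_ne_zero_of_mem_edgesAt {x : Λ.Vert} {e : Λ.Path} (he : e ∈ Λ.edgesAt x) :
    Λ.d e ≠ 0 := by
  obtain ⟨-, i, hi⟩ := he
  intro h
  have := congrFun (hi.symm.trans h) i
  simp at this

theorem d_eq_zero_iff_forall_edge {c : Λ.Path} :
    Λ.d c = 0 ↔ ∀ e ∈ Λ.edgesAt (Λ.r c), ¬ Λ.IsInitial e c := by
  refine ⟨?_, fun h => by_contra fun hc => ?_⟩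
  · rintro hc e he ⟨b, h, rfl⟩
    rw [Λ.d_comp, add_eq_zero] at hc
    exact d_ne_zero_of_mem_edgesAt he hc.1
  · obtain ⟨e, he, hi⟩ := exists_edge_isInitial hc
    exact h e he hi

/-- If `a` is an initial segment of `bc`, then `c` has an initial segment `q` such that
`(p, q) ∈ Λ^min(a, b)` for some `p`. -/
theorem exists_minExt {a b c : Λ.Path} (h : Λ.s b = Λ.r c) (ha : Λ.IsInitial a (Λ.comp b c h)) :
    ∃ p ∈ Λ.minExt a b, Λ.IsInitial p.2 c := by
  have hb : Λ.IsInitial b (Λ.comp b c h) := ⟨c, h, rfl⟩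
  have hle : Λ.d a ⊔ Λ.d b ≤ Λ.d (Λ.comp b c h) := by
    refine sup_le ?_ ?_
    · obtain ⟨y, hy, he⟩ := ha
      rw [← he, Λ.d_comp]
      exact le_self_add
    · rw [Λ.d_comp]
      exact le_self_add
  obtain ⟨e, x, hx, hde, he⟩ := exists_comp_of_le hle
  have hi : Λ.IsInitial e (Λ.comp b c h) := ⟨x, hx, he⟩
  have hae := ha.of_le hi (hde ▸ le_sup_left)
  have hbe := hb.of_le hi (hde ▸ le_sup_right)
  obtain ⟨p, hp, hpe⟩ := id hae
  obtain ⟨q, hq, hqe⟩ := id hbe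
  subst hqe
  refine ⟨(p, q), ⟨hp, hq, hpe, hpe ▸ ⟨hde, hae, hbe⟩⟩, x, ?_, ?_⟩
  · rw [← hx, Λ.s_comp]
  · rw [Λ.assoc b q x hq ((Λ.s_comp _ _ _).symm.trans hx)] at he
    exact comp_left_cancel he

/-- A pair in `Λ^min(a, b)` is determined by any path that its second entry begins. -/
theorem minExt_unique {a b c : Λ.Path} {p q : Λ.Path × Λ.Path} (hp : p ∈ Λ.minExt a b)
    (hq : q ∈ Λ.minExt a b) (hpc : Λ.IsInitial p.2 c) (hqc : Λ.IsInitial q.2 c) : p = q := by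
  obtain ⟨h1, h2, he, hd, -⟩ := hp
  obtain ⟨h1', h2', he', hd', -⟩ := hq
  obtain ⟨y, hy, rfl⟩ := hpc
  obtain ⟨z, hz, hc⟩ := hqc
  rw [he, Λ.d_comp] at hd
  rw [he', Λ.d_comp] at hd'
  have h22 := (comp_inj (add_left_cancel (hd'.trans hd.symm)) hc).1
  refine Prod.ext ?_ h22.symm
  refine comp_left_cancel (h := h1) (h' := h1') (he.trans (Eq.trans ?_ he'.symm))
  congr 1
  exact h22.symm

/-! ### The representation on finite paths -/

section PathRep

variable (R : Type w) [CommRing R]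

open Classical in
/-- The operator `δ_b ↦ δ_{ab}` (zero if `ab` is undefined) on the free module on all paths. -/
noncomputable def shift (a : Λ.Path) : Module.End R (Λ.Path →₀ R) :=
  Finsupp.linearCombination R fun b =>
    if h : Λ.s a = Λ.r b then Finsupp.single (Λ.comp a b h) 1 else 0

open Classical in
/-- The operator `δ_{ab} ↦ δ_b` on the free module on all paths; it annihilates `δ_c` if `a` is not
an initial segment of `c`. -/
noncomputable def backshift (a : Λ.Path) : Module.End R (Λ.Path →₀ R) :=
  Finsupp.linearCombination R fun c =>
    if h : Λ.IsInitial a c then Finsupp.single h.choose 1 else 0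

variable {R}

theorem shift_single {a b : Λ.Path} (h : Λ.s a = Λ.r b) :
    shift R a (Finsupp.single b 1) = Finsupp.single (Λ.comp a b h) 1 := by
  simp [shift, h]

theorem shift_single_of_ne {a b : Λ.Path} (h : Λ.s a ≠ Λ.r b) :
    shift R a (Finsupp.single b 1) = 0 := by
  simp [shift, h]

theorem backshift_single {a b : Λ.Path} (h : Λ.s a = Λ.r b) :
    backshift R a (Finsupp.single (Λ.comp a b h) 1) = Finsupp.single b 1 := by
  have hi : Λ.IsInitial a (Λ.comp a b h) := ⟨b, h, rfl⟩
  obtain ⟨h', hc⟩ := hi.choose_spec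
  have := comp_left_cancel hc
  simp [backshift, hi, this]

theorem backshift_single_of_not {a c : Λ.Path} (h : ¬ Λ.IsInitial a c) :
    backshift R a (Finsupp.single c 1) = 0 := by
  simp [backshift, h]

theorem shift_idn_single {x : Λ.Vert} {c : Λ.Path} (h : Λ.r c = x) :
    shift R (Λ.idn x) (Finsupp.single c 1) = Finsupp.single c 1 := by
  subst h
  rw [shift_single (Λ.s_idn _), Λ.idn_comp]

theorem shift_idn_single_of_ne {x : Λ.Vert} {c : Λ.Path} (h : Λ.r c ≠ x) :
    shift R (Λ.idn x) (Finsupp.single c 1) = 0 :=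
  shift_single_of_ne fun h' => h (h'.symm.trans (Λ.s_idn x))

theorem shift_backshift_single {a c : Λ.Path} (h : Λ.IsInitial a c) :
    shift R a (backshift R a (Finsupp.single c 1)) = Finsupp.single c 1 := by
  obtain ⟨b, h, rfl⟩ := h
  rw [backshift_single, shift_single h]

theorem end_ext {M : Type*} [AddCommGroup M] [Module R M] {f g : (Λ.Path →₀ R) →ₗ[R] M}
    (h : ∀ c, f (Finsupp.single c 1) = g (Finsupp.single c 1)) : f = g :=
  Finsupp.lhom_ext' fun c => LinearMap.ext_ring (h c)

variable (Λ R)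

theorem isCohnFamily_shift (hΛ : Λ.RowFinite) :
    IsCohnFamily Λ (shift R : Λ.Path → _) (backshift R) where
  ghost_idn x := end_ext fun c => by
    by_cases h : Λ.r c = x
    · subst h
      rw [shift_idn_single rfl]
      have := backshift_single (R := R) (Λ.s_idn (Λ.r c))
      rwa [Λ.idn_comp] at this
    · rw [shift_idn_single_of_ne h, backshift_single_of_not (mt isInitial_idn_iff.1 h)]
  idem x := end_ext fun c => by
    rw [Module.End.mul_apply]
    by_cases h : Λ.r c = x
    · rw [shift_idn_single h, shift_idn_single h]
    · rw [shift_idn_single_of_ne h, map_zero]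
  orth x y hxy := end_ext fun c => by
    rw [Module.End.mul_apply, LinearMap.zero_apply]
    by_cases h : Λ.r c = y
    · rw [shift_idn_single h, shift_idn_single_of_ne fun h' => hxy (h'.symm.trans h)]
    · rw [shift_idn_single_of_ne h, map_zero]
  mul_path a b h := end_ext fun c => by
    rw [Module.End.mul_apply]
    by_cases h' : Λ.s b = Λ.r c
    · rw [shift_single h', shift_single (h.trans (Λ.r_comp _ _ _).symm),
        shift_single ((Λ.s_comp _ _ _).trans h'), Λ.assoc]
    · rw [shift_single_of_ne h', map_zero, shift_single_of_ne]
      rwa [Λ.s_comp]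
  mul_ghost a b h := end_ext fun c => by
    rw [Module.End.mul_apply]
    by_cases hi : Λ.IsInitial (Λ.comp a b h) c
    · obtain ⟨y, hy, rfl⟩ := hi
      rw [backshift_single, Λ.assoc a b y h ((Λ.s_comp _ _ _).symm.trans hy), backshift_single,
        backshift_single]
    · rw [backshift_single_of_not hi]
      by_cases ha : Λ.IsInitial a c
      · obtain ⟨y, hy, rfl⟩ := ha
        rw [backshift_single, backshift_single_of_not]
        rintro ⟨z, hz, rfl⟩
        exact hi ⟨z, (Λ.s_comp _ _ _).trans hz, Λ.assoc _ _ _ _ _⟩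
      · rw [backshift_single_of_not ha, map_zero]
  ghost_mul_path a b := end_ext fun c => by
    have hsum : (∑ᶠ p ∈ Λ.minExt a b, shift R p.1 * backshift R p.2) (Finsupp.single c 1) =
        ∑ᶠ p ∈ Λ.minExt a b, shift R p.1 (backshift R p.2 (Finsupp.single c 1)) :=
      (AddMonoidHom.map_finsum_mem _
        (LinearMap.applyₗ (R := R) (Finsupp.single c (1 : R))).toAddMonoidHom
        (hΛ.minExt_finite a b))
    classical
    rw [hsum, Module.End.mul_apply]
    by_cases hex : ∃ p ∈ Λ.minExt a b, Λ.IsInitial p.2 c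
    · obtain ⟨⟨p, q⟩, hp, hi⟩ := hex
      rw [finsum_eq_single _ (p, q) fun z hz => ?_, finsum_eq_if, if_pos hp]
      · obtain ⟨h, h', he, -⟩ := id hp
        obtain ⟨y, hy, rfl⟩ := hi
        simp only at h h' he hy ⊢
        have hpy : Λ.s p = Λ.r y := by
          rw [← hy, ← Λ.s_comp b q h', ← he, Λ.s_comp]
        have hc : Λ.comp b (Λ.comp q y hy) (h'.trans (Λ.r_comp _ _ _).symm) =
            Λ.comp a (Λ.comp p y hpy) (h.trans (Λ.r_comp _ _ _).symm) := by
          rw [← Λ.assoc a p y h hpy, ← Λ.assoc b q y h' hy]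
          congr 1
          exact he.symm
        rw [backshift_single, shift_single hpy, shift_single (h'.trans (Λ.r_comp _ _ _).symm), hc,
          backshift_single]
      · rw [finsum_eq_if]
        split_ifs with hz'
        · rw [backshift_single_of_not fun hi' => hz (minExt_unique hz' hp hi' hi), map_zero]
        · rfl
    · rw [finsum_mem_eq_zero_of_forall_eq_zero]
      · by_cases h : Λ.s b = Λ.r c
        · rw [shift_single h, backshift_single_of_not fun hi => hex (exists_minExt h hi)]
        · rw [shift_single_of_ne h, map_zero]
      · intro p hp
        rw [backshift_single_of_not fun hi => hex ⟨p, hp, hi⟩, map_zero]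

end PathRep

/-! ### Consequences of the Cohn relations -/

section Cohn

variable {A : Type w} [NonUnitalRing A] {T Tstar : Λ.Path → A}

theorem IsCohnFamily.idn_mul_path (hT : IsCohnFamily Λ T Tstar) {x : Λ.Vert} {a : Λ.Path}
    (h : Λ.r a = x) : T (Λ.idn x) * T a = T a := by
  subst h
  rw [hT.mul_path _ _ (Λ.s_idn _), Λ.idn_comp]

theorem IsCohnFamily.path_mul_idn (hT : IsCohnFamily Λ T Tstar) {x : Λ.Vert} {a : Λ.Path}
    (h : Λ.s a = x) : T a * T (Λ.idn x) = T a := by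
  subst h
  rw [hT.mul_path _ _ (Λ.r_idn _).symm, Λ.comp_idn]

theorem IsCohnFamily.idn_mul_ghost (hT : IsCohnFamily Λ T Tstar) {x : Λ.Vert} {a : Λ.Path}
    (h : Λ.s a = x) : T (Λ.idn x) * Tstar a = Tstar a := by
  subst h
  rw [← hT.ghost_idn, hT.mul_ghost _ _ (Λ.r_idn _).symm, Λ.comp_idn]

theorem IsCohnFamily.ghost_mul_idn (hT : IsCohnFamily Λ T Tstar) {x : Λ.Vert} {a : Λ.Path}
    (h : Λ.r a = x) : Tstar a * T (Λ.idn x) = Tstar a := by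
  subst h
  rw [← hT.ghost_idn, hT.mul_ghost _ _ (Λ.s_idn _), Λ.idn_comp]

theorem IsCohnFamily.path_mul_path_of_ne (hT : IsCohnFamily Λ T Tstar) {a b : Λ.Path}
    (h : Λ.s a ≠ Λ.r b) : T a * T b = 0 := by
  rw [← hT.path_mul_idn (a := a) rfl, ← hT.idn_mul_path (a := b) rfl, mul_assoc,
    ← mul_assoc (T (Λ.idn _)), hT.orth _ _ h, zero_mul, mul_zero]

theorem IsCohnFamily.ghost_mul_ghost_of_ne (hT : IsCohnFamily Λ T Tstar) {a b : Λ.Path}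
    (h : Λ.s a ≠ Λ.r b) : Tstar b * Tstar a = 0 := by
  rw [← hT.ghost_mul_idn (a := b) rfl, ← hT.idn_mul_ghost (a := a) rfl, mul_assoc,
    ← mul_assoc (T (Λ.idn _)), hT.orth _ _ h.symm, zero_mul, mul_zero]

theorem IsCohnFamily.path_mul_ghost_of_ne (hT : IsCohnFamily Λ T Tstar) {a b : Λ.Path}
    (h : Λ.s a ≠ Λ.s b) : T a * Tstar b = 0 := by
  rw [← hT.path_mul_idn (a := a) rfl, ← hT.idn_mul_ghost (a := b) rfl, mul_assoc,
    ← mul_assoc (T (Λ.idn _)), hT.orth _ _ h, zero_mul, mul_zero]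

theorem IsCohnFamily.ghost_mul_path_of_ne (hT : IsCohnFamily Λ T Tstar) {a b : Λ.Path}
    (h : Λ.r a ≠ Λ.r b) : Tstar a * T b = 0 := by
  rw [← hT.ghost_mul_idn (a := a) rfl, ← hT.idn_mul_path (a := b) rfl, mul_assoc,
    ← mul_assoc (T (Λ.idn _)), hT.orth _ _ h, zero_mul, mul_zero]

theorem IsCohnFamily.idn_mul_gapProd (hT : IsCohnFamily Λ T Tstar) {x : Λ.Vert} {l : List Λ.Path}
    (hl : ∀ a ∈ l, Λ.r a = x) :
    T (Λ.idn x) * gapProd Λ T Tstar x l = gapProd Λ T Tstar x l := by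
  cases l with
  | nil => exact hT.idem x
  | cons a l =>
    simp only [gapProd, List.foldr_cons]
    rw [← mul_assoc, mul_sub, hT.idem, ← mul_assoc, hT.idn_mul_path (hl a (by simp))]

/-- Products of spanning elements `T_a T_{b*}` of a Cohn algebra are sums of such elements. -/
theorem IsCohnFamily.mul_mul_mul_mem (hT : IsCohnFamily Λ T Tstar) (hΛ : Λ.RowFinite)
    {a b c d : Λ.Path} (S : AddSubmonoid A)
    (h : ∀ (p q : Λ.Path) (_ : (p, q) ∈ Λ.minExt b c) (hp : Λ.s a = Λ.r p) (hq : Λ.s d = Λ.r q),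
      T (Λ.comp a p hp) * Tstar (Λ.comp d q hq) ∈ S) :
    (T a * Tstar b) * (T c * Tstar d) ∈ S := by
  have h1 : (T a * Tstar b) * (T c * Tstar d) = T a * (Tstar b * T c) * Tstar d := by
    simp only [mul_assoc]
  have h2 := ((AddMonoidHom.mulRight (Tstar d)).comp (AddMonoidHom.mulLeft (T a))).map_finsum_mem
    (fun p : Λ.Path × Λ.Path => T p.1 * Tstar p.2) (hΛ.minExt_finite b c)
  rw [← hT.ghost_mul_path] at h2
  rw [h1]
  refine Eq.mpr (congrArg (· ∈ S) h2)
    (finsum_mem_induction (· ∈ S) S.zero_mem (fun _ _ => S.add_mem) ?_)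
  rintro ⟨p, q⟩ hpq
  change T a * (T p * Tstar q) * Tstar d ∈ S
  have h3 : T a * (T p * Tstar q) * Tstar d = (T a * T p) * (Tstar q * Tstar d) := by
    simp only [mul_assoc]
  rw [h3]
  by_cases hp : Λ.s a = Λ.r p
  · by_cases hq : Λ.s d = Λ.r q
    · rw [hT.mul_path _ _ hp, hT.mul_ghost _ _ hq]
      exact h p q hpq hp hq
    · rw [hT.ghost_mul_ghost_of_ne hq, mul_zero]
      exact S.zero_mem
  · rw [hT.path_mul_path_of_ne hp, zero_mul]
    exact S.zero_mem

end Cohn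

/-! ### The spanning set of the Cohn path algebra -/

theorem PresAlg.submodule_eq_top {R : Type w} [CommRing R] {X : Type v}
    {rel : FreeAlg R X → FreeAlg R X → Prop} {p : Submodule R (PresAlg R rel)}
    (hgen : ∀ x, PresAlg.mk R rel (FreeAlg.gen R x) ∈ p) (hmul : ∀ y ∈ p, ∀ z ∈ p, y * z ∈ p) :
    p = ⊤ := by
  have hword : ∀ w : FreeSemigroup X, PresAlg.mk R rel (MonoidAlgebra.single w 1) ∈ p := by
    intro w
    induction w using FreeSemigroup.recOnMul with
    | ih1 x => exact hgen x
    | ih2 x y hx hy =>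
      have : (MonoidAlgebra.single (FreeSemigroup.of x * y) 1 : FreeAlg R X) =
          MonoidAlgebra.single (FreeSemigroup.of x) 1 * MonoidAlgebra.single y 1 := by
        rw [MonoidAlgebra.single_mul_single, one_mul]
      rw [this, PresAlg.mk_mul]
      exact hmul _ hx _ hy
  refine eq_top_iff.2 fun y _ => ?_
  obtain ⟨a, rfl⟩ := PresAlg.mk_surjective R rel y
  induction a using MonoidAlgebra.induction_linear with
  | zero => exact p.zero_mem
  | add f g hf hg => exact p.add_mem (hf trivial) (hg trivial)
  | single w c =>
    have : (MonoidAlgebra.single w c : FreeAlg R X) = c • MonoidAlgebra.single w 1 := by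
      rw [MonoidAlgebra.smul_single, smul_eq_mul, mul_one]
    rw [this, PresAlg.mk_smul]
    exact p.smul_mem _ (hword w)

section CohnAlg

variable (R : Type w) [CommRing R]

theorem CohnAlg.span_eq_top (hΛ : Λ.RowFinite) :
    Submodule.span R {y | ∃ a b : Λ.Path, y = CohnAlg.path Λ R a * CohnAlg.ghost Λ R b} = ⊤ := by
  have hT := CohnAlg.isCohnFamily (Λ := Λ) R hΛ
  refine PresAlg.submodule_eq_top ?_ ?_
  · rintro (a | a)
    · refine Submodule.subset_span ⟨a, Λ.idn (Λ.s a), ?_⟩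
      rw [hT.ghost_idn, hT.path_mul_idn rfl]
      rfl
    · refine Submodule.subset_span ⟨Λ.idn (Λ.s a), a, ?_⟩
      rw [hT.idn_mul_ghost rfl]
      rfl
  · intro y hy z hz
    induction hy, hz using Submodule.span_induction₂ with
    | mem_mem y z hy hz =>
      obtain ⟨a, b, rfl⟩ := hy
      obtain ⟨c, d, rfl⟩ := hz
      exact hT.mul_mul_mul_mem hΛ (Submodule.toAddSubmonoid _)
        fun p q _ hp hq => Submodule.subset_span ⟨_, _, rfl⟩
    | zero_left z _ => rw [zero_mul]; exact Submodule.zero_mem _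
    | zero_right z _ => rw [mul_zero]; exact Submodule.zero_mem _
    | add_left x y z _ _ _ hx hy => rw [add_mul]; exact Submodule.add_mem _ hx hy
    | add_right x y z _ _ _ hx hy => rw [mul_add]; exact Submodule.add_mem _ hx hy
    | smul_left c x y _ _ h => rw [smul_mul_assoc]; exact Submodule.smul_mem _ c h
    | smul_right c x y _ _ h => rw [mul_smul_comm]; exact Submodule.smul_mem _ c h

theorem CohnAlg.grade_mul (hΛ : Λ.RowFinite) {m n : Fin k → ℤ} {y z : CohnAlg Λ R}
    (hy : y ∈ CohnAlg.grade Λ R m) (hz : z ∈ CohnAlg.grade Λ R n) :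
    y * z ∈ CohnAlg.grade Λ R (m + n) := by
  have hT := CohnAlg.isCohnFamily (Λ := Λ) R hΛ
  induction hy, hz using Submodule.span_induction₂ with
  | mem_mem y z hy hz =>
    obtain ⟨a, b, hm, rfl⟩ := hy
    obtain ⟨c, d, hn, rfl⟩ := hz
    refine hT.mul_mul_mul_mem hΛ (Submodule.toAddSubmonoid _)
      fun p q hpq hp hq => Submodule.subset_span ⟨_, _, fun i => ?_, rfl⟩
    obtain ⟨h, h', he, -⟩ := hpq
    have hd := congrArg (fun e => Λ.d e i) he
    simp only [Λ.d_comp, Pi.add_apply] at hd ⊢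
    rw [← hm i, ← hn i]
    push_cast
    have : (Λ.d b i : ℤ) + Λ.d p i = Λ.d c i + Λ.d q i := by exact_mod_cast hd
    linarith
  | zero_left z _ => rw [zero_mul]; exact Submodule.zero_mem _
  | zero_right z _ => rw [mul_zero]; exact Submodule.zero_mem _
  | add_left x y z _ _ _ hx hy => rw [add_mul]; exact Submodule.add_mem _ hx hy
  | add_right x y z _ _ _ hx hy => rw [mul_add]; exact Submodule.add_mem _ hx hy
  | smul_left c x y _ _ h => rw [smul_mul_assoc]; exact Submodule.smul_mem _ c h
  | smul_right c x y _ _ h => rw [mul_smul_comm]; exact Submodule.smul_mem _ c h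

/-! ### Faithfulness of the path representation, and the grading -/

/-- The representation of the Cohn path algebra on the free module on all finite paths. -/
noncomputable def CohnAlg.pathRep (hΛ : Λ.RowFinite) :
    CohnAlg Λ R →ₙₐ[R] Module.End R (Λ.Path →₀ R) :=
  (CohnAlg.existsUnique_lift R hΛ (isCohnFamily_shift Λ R hΛ)).choose

theorem CohnAlg.pathRep_path (hΛ : Λ.RowFinite) (a : Λ.Path) :
    CohnAlg.pathRep R hΛ (CohnAlg.path Λ R a) = shift R a :=
  (CohnAlg.existsUnique_lift R hΛ (isCohnFamily_shift Λ R hΛ)).choose_spec.1.1 a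

theorem CohnAlg.pathRep_ghost (hΛ : Λ.RowFinite) (a : Λ.Path) :
    CohnAlg.pathRep R hΛ (CohnAlg.ghost Λ R a) = backshift R a :=
  (CohnAlg.existsUnique_lift R hΛ (isCohnFamily_shift Λ R hΛ)).choose_spec.1.2 a

/-- The operators `T_a T_{b*}` with `s(a) = s(b)` are linearly independent: applied to `δ_c`, a
relation among them retains only the terms for which `b` is an initial segment of `c`, and by
induction on the degree only those with `b = c` matter; these give distinct basis vectors `δ_a`. -/
theorem eq_zero_of_sum_shift_backshift_eq_zero {l : {p : Λ.Path × Λ.Path // Λ.s p.1 = Λ.s p.2} →₀ R}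
    (hl : ∀ c, (l.sum fun p t => t • shift R p.1.1 (backshift R p.1.2 (Finsupp.single c 1))) = 0) :
    l = 0 := by
  suffices H : ∀ (N : ℕ) (p : {p : Λ.Path × Λ.Path // Λ.s p.1 = Λ.s p.2}),
      ∑ i, Λ.d p.1.2 i = N → l p = 0 from Finsupp.ext fun p => H _ p rfl
  intro N
  induction N using Nat.strong_induction_on with
  | _ N ih =>
    rintro ⟨⟨a, b⟩, hab⟩ hN
    simp only at hab hN
    have h0 := DFunLike.congr_fun (hl b) a
    rw [Finsupp.sum, Finsupp.finsetSum_apply] at h0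
    rw [Finset.sum_eq_single (⟨(a, b), hab⟩ : {p : Λ.Path × Λ.Path // Λ.s p.1 = Λ.s p.2})] at h0
    · have hbi : Λ.comp b (Λ.idn (Λ.s b)) (Λ.r_idn _).symm = b := Λ.comp_idn b
      have h1 : backshift R b (Finsupp.single b 1) = Finsupp.single (Λ.idn (Λ.s b)) 1 := by
        have := backshift_single (R := R) (Λ.r_idn (Λ.s b)).symm
        rwa [hbi] at this
      rw [h1,
        shift_single (hab.trans (Λ.r_idn _).symm), comp_of_d_eq_zero _ (Λ.d_idn _)] at h0
      simpa using h0
    · rintro ⟨⟨a', b'⟩, hab'⟩ - hne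
      simp only at hab' ⊢
      by_cases hi : Λ.IsInitial b' b
      · obtain ⟨x, hx, rfl⟩ := hi
        by_cases hx0 : Λ.d x = 0
        · rw [backshift_single,
            shift_single (hab'.trans hx), comp_of_d_eq_zero _ hx0, Finsupp.smul_apply,
            Finsupp.single_eq_of_ne, smul_zero]
          rintro rfl
          refine hne (Subtype.ext (Prod.ext rfl ?_))
          exact (comp_of_d_eq_zero hx hx0).symm
        · rw [ih (∑ i, Λ.d b' i) ?_ ⟨(a', b'), hab'⟩ rfl, zero_smul]
          · rfl
          · rw [← hN, Λ.d_comp]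
            simp only [Pi.add_apply, Finset.sum_add_distrib]
            obtain ⟨i, hxi⟩ : ∃ i, Λ.d x i ≠ 0 := by
              by_contra! hcon
              exact hx0 (funext hcon)
            have := Finset.single_le_sum (f := Λ.d x) (fun _ _ => Nat.zero_le _)
              (Finset.mem_univ i)
            omega
      · rw [backshift_single_of_not hi, map_zero,
          smul_zero]
        rfl
    · intro h
      rw [Finsupp.notMem_support_iff.1 h, zero_smul]
      rfl

theorem CohnAlg.eq_zero_of_pathRep_eq_zero (hΛ : Λ.RowFinite)
    {l : {p : Λ.Path × Λ.Path // Λ.s p.1 = Λ.s p.2} →₀ R}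
    (hl : CohnAlg.pathRep R hΛ
      (l.sum fun p t => t • (CohnAlg.path Λ R p.1.1 * CohnAlg.ghost Λ R p.1.2)) = 0) : l = 0 := by
  refine eq_zero_of_sum_shift_backshift_eq_zero R fun c => ?_
  have h := LinearMap.congr_fun hl (Finsupp.single c 1)
  rw [Finsupp.sum, map_sum, LinearMap.sum_apply, LinearMap.zero_apply] at h
  rw [Finsupp.sum, ← h]
  refine Finset.sum_congr rfl fun p _ => ?_
  rw [map_smul, map_mul, CohnAlg.pathRep_path, CohnAlg.pathRep_ghost, LinearMap.smul_apply,
    Module.End.mul_apply]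

theorem CohnAlg.span_range_eq_top (hΛ : Λ.RowFinite) :
    Submodule.span R (Set.range fun p : {p : Λ.Path × Λ.Path // Λ.s p.1 = Λ.s p.2} =>
        CohnAlg.path Λ R p.1.1 * CohnAlg.ghost Λ R p.1.2) = ⊤ := by
  rw [eq_top_iff, ← CohnAlg.span_eq_top R hΛ, Submodule.span_le]
  rintro y ⟨a, b, rfl⟩
  by_cases h : Λ.s a = Λ.s b
  · exact Submodule.subset_span ⟨⟨(a, b), h⟩, rfl⟩
  · rw [(CohnAlg.isCohnFamily R hΛ).path_mul_ghost_of_ne h]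
    exact Submodule.zero_mem _

theorem CohnAlg.pathRep_injective (hΛ : Λ.RowFinite) :
    Function.Injective (CohnAlg.pathRep R hΛ) := by
  rw [injective_iff_map_eq_zero]
  intro y hy
  obtain ⟨l, rfl⟩ := (Finsupp.mem_span_range_iff_exists_finsupp).1
    ((CohnAlg.span_range_eq_top R hΛ).ge (Submodule.mem_top (x := y)))
  rw [CohnAlg.eq_zero_of_pathRep_eq_zero R hΛ hy, Finsupp.sum_zero_index]

theorem CohnAlg.isInternal_grade (hΛ : Λ.RowFinite) :
    DirectSum.IsInternal (CohnAlg.grade Λ R) := by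
  set f := fun p : {p : Λ.Path × Λ.Path // Λ.s p.1 = Λ.s p.2} =>
    CohnAlg.path Λ R p.1.1 * CohnAlg.ghost Λ R p.1.2 with hf
  have hli : LinearIndependent R f := linearIndependent_iff.2 fun l hl =>
    CohnAlg.eq_zero_of_pathRep_eq_zero R hΛ (by
      rw [Finsupp.linearCombination_apply] at hl
      rw [hl, map_zero])
  let D : (Fin k → ℤ) → Set {p : Λ.Path × Λ.Path // Λ.s p.1 = Λ.s p.2} := fun n =>
    {p | ∀ i, (Λ.d p.1.1 i : ℤ) - (Λ.d p.1.2 i : ℤ) = n i}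
  have hgrade : ∀ n, CohnAlg.grade Λ R n = Submodule.span R (f '' D n) := by
    intro n
    refine le_antisymm (Submodule.span_le.2 ?_) (Submodule.span_mono ?_)
    · rintro y ⟨a, b, hd, rfl⟩
      by_cases h : Λ.s a = Λ.s b
      · exact Submodule.subset_span ⟨⟨(a, b), h⟩, hd, rfl⟩
      · rw [(CohnAlg.isCohnFamily R hΛ).path_mul_ghost_of_ne h]
        exact Submodule.zero_mem _
    · rintro y ⟨p, hp, rfl⟩
      exact ⟨p.1.1, p.1.2, hp, rfl⟩
  rw [DirectSum.isInternal_submodule_iff_iSupIndep_and_iSup_eq_top, iSupIndep_def]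
  simp only [hgrade]
  constructor
  · intro n
    have hsup : (⨆ m, ⨆ (_ : m ≠ n), Submodule.span R (f '' D m)) ≤
        Submodule.span R (f '' ⋃ m, ⋃ (_ : m ≠ n), D m) := by
      refine iSup₂_le fun m hm => Submodule.span_mono (Set.image_mono ?_)
      exact Set.subset_iUnion₂_of_subset m hm subset_rfl
    refine (hli.disjoint_span_image ?_).mono_right hsup
    rw [Set.disjoint_left]
    intro p hp hp'
    obtain ⟨m, hm, hpm⟩ := Set.mem_iUnion₂.1 hp'
    exact hm (funext fun i => (hpm i).symm.trans (hp i))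
  · rw [iSup_congr hgrade, ← Submodule.span_iUnion, ← Set.image_iUnion, eq_top_iff,
      ← CohnAlg.span_range_eq_top R hΛ, ← Set.image_univ]
    refine Submodule.span_mono (Set.image_mono fun p _ => Set.mem_iUnion.2 ?_)
    exact ⟨fun i => (Λ.d p.1.1 i : ℤ) - (Λ.d p.1.2 i : ℤ), fun i => rfl⟩

end CohnAlg

/-! ### Intertwining with a Cohn family of operators -/

section Intertwine

variable {R : Type w} [CommRing R]

open Classical in
theorem gapProd_shift_single (x : Λ.Vert) (l : List Λ.Path) (c : Λ.Path) :
    gapProd Λ (shift R) (backshift R) x l (Finsupp.single c 1) =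
      if Λ.r c = x ∧ ∀ a ∈ l, ¬ Λ.IsInitial a c then Finsupp.single c 1 else 0 := by
  induction l with
  | nil =>
    by_cases h : Λ.r c = x
    · simp [gapProd, h, shift_idn_single h]
    · simp [gapProd, h, shift_idn_single_of_ne h]
  | cons a l ih =>
    simp only [gapProd, List.foldr_cons] at ih ⊢
    rw [Module.End.mul_apply, ih]
    by_cases h : Λ.r c = x ∧ ∀ a ∈ l, ¬ Λ.IsInitial a c
    · rw [if_pos h, LinearMap.sub_apply, Module.End.mul_apply, shift_idn_single h.1]
      by_cases ha : Λ.IsInitial a c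
      · rw [shift_backshift_single ha, sub_self, if_neg]
        simp [ha]
      · rw [backshift_single_of_not ha, map_zero, sub_zero, if_pos]
        simpa [ha] using h
    · rw [if_neg h, map_zero, if_neg]
      exact fun h' => h ⟨h'.1, fun b hb => h'.2 b (List.mem_cons_of_mem _ hb)⟩

open Classical in
/-- In the path representation `F_x` is the projection onto the paths of nonzero degree with range
`x`: these are the paths with range `x` that begin with an edge. -/
theorem vertexRange_shift_single (hΛ : Λ.RowFinite) (x : Λ.Vert) (c : Λ.Path) :
    vertexRange hΛ (shift R) (backshift R) x (Finsupp.single c 1) =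
      if Λ.r c = x ∧ Λ.d c ≠ 0 then Finsupp.single c 1 else 0 := by
  rw [vertexRange, LinearMap.sub_apply, gapProd_shift_single]
  simp only [Finset.mem_toList, Set.Finite.mem_toFinset]
  by_cases h : Λ.r c = x
  · subst h
    rw [shift_idn_single rfl, ← d_eq_zero_iff_forall_edge]
    by_cases hd : Λ.d c = 0 <;> simp [hd]
  · simp [h, shift_idn_single_of_ne h]

variable {M : Type*} [AddCommGroup M] [Module R M] {N : Type*} [AddCommGroup N] [Module R N]
  {A : Type*} [NonUnitalRing A]

/-- Let `Φ` be a faithful representation of `A` on `M` and `j : M → N` an embedding. If `j`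
intertwines the operators `Φ(S_a)`, `Φ(S_{a*})` with a Cohn family on `N`, then the `S_a`, `S_{a*}`
form a Cohn family in `A`. -/
theorem IsCohnFamily.of_intertwines (hΛ : Λ.RowFinite) {U Ustar : Λ.Path → Module.End R N}
    (hU : IsCohnFamily Λ U Ustar) {Φ : A →ₙ+* Module.End R M} (hΦ : Function.Injective Φ)
    {j : M →ₗ[R] N} (hj : Function.Injective j) {S Sstar : Λ.Path → A}
    (hS : ∀ a m, j (Φ (S a) m) = U a (j m)) (hS' : ∀ a m, j (Φ (Sstar a) m) = Ustar a (j m)) :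
    IsCohnFamily Λ S Sstar := by
  have key : ∀ {y z : A}, (∀ m, j (Φ y m) = j (Φ z m)) → y = z := fun h =>
    hΦ (LinearMap.ext fun m => hj (h m))
  refine ⟨fun x => key fun m => ?_, fun x => key fun m => ?_, fun x y hxy => key fun m => ?_,
    fun a b h => key fun m => ?_, fun a b h => key fun m => ?_, fun a b => key fun m => ?_⟩
  · rw [hS, hS', hU.ghost_idn]
  · rw [map_mul, Module.End.mul_apply, hS, hS, ← Module.End.mul_apply, hU.idem]
  · rw [map_mul, Module.End.mul_apply, hS, hS, ← Module.End.mul_apply, hU.orth _ _ hxy, map_zero]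
    simp
  · rw [map_mul, Module.End.mul_apply, hS, hS, ← Module.End.mul_apply, hU.mul_path _ _ h, hS]
  · rw [map_mul, Module.End.mul_apply, hS', hS', ← Module.End.mul_apply, hU.mul_ghost _ _ h, hS']
  · have hfin := hΛ.minExt_finite a b
    have hA : j (Φ (∑ᶠ p ∈ Λ.minExt a b, S p.1 * Sstar p.2) m) =
        ∑ᶠ p ∈ Λ.minExt a b, j (Φ (S p.1 * Sstar p.2) m) :=
      (j.toAddMonoidHom.comp ((LinearMap.applyₗ (R := R) m).toAddMonoidHom.comp
        (Φ : A →+ Module.End R M))).map_finsum_mem _ hfin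
    have hB : (∑ᶠ p ∈ Λ.minExt a b, U p.1 * Ustar p.2) (j m) =
        ∑ᶠ p ∈ Λ.minExt a b, (U p.1 * Ustar p.2) (j m) :=
      ((LinearMap.applyₗ (R := R) (j m)).toAddMonoidHom).map_finsum_mem _ hfin
    rw [map_mul, Module.End.mul_apply, hS', hS, ← Module.End.mul_apply, hU.ghost_mul_path, hA, hB]
    simp only [map_mul, Module.End.mul_apply, hS, hS']

theorem gapProd_intertwines {U Ustar : Λ.Path → Module.End R N}
    {Φ : A →ₙ+* Module.End R M} {j : M →ₗ[R] N} {S Sstar : Λ.Path → A}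
    (hS : ∀ a m, j (Φ (S a) m) = U a (j m)) (hS' : ∀ a m, j (Φ (Sstar a) m) = Ustar a (j m))
    (x : Λ.Vert) (l : List Λ.Path) (m : M) :
    j (Φ (gapProd Λ S Sstar x l) m) = gapProd Λ U Ustar x l (j m) := by
  induction l generalizing m with
  | nil => exact hS _ m
  | cons a l ih =>
    simp only [gapProd, List.foldr_cons] at ih ⊢
    simp only [map_mul, map_sub, Module.End.mul_apply, LinearMap.sub_apply, hS, hS', ih]

end Intertwine

/-! ### Paths of `TΛ` -/

section Toeplitz

/-- The vertex `α(x)` of `TΛ`. -/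
def alphaV (x : Λ.Vert) : Λ.toeplitz.Vert := Sum.inl x

/-- The vertex `β(x)` of `TΛ`. -/
def betaV (x : Λ.Vert) : Λ.toeplitz.Vert := Sum.inr x

/-- The path `α(a)` of `TΛ`. -/
def alpha (a : Λ.Path) : Λ.toeplitz.Path := Sum.inl a

/-- The path `β(a)` of `TΛ`. -/
def beta (a : Λ.Path) : Λ.toeplitz.Path := Sum.inr a

theorem toeplitz_cases (τ : Λ.toeplitz.Path) : (∃ a, τ = alpha a) ∨ ∃ a, τ = beta a :=
  match τ with
  | Sum.inl a => Or.inl ⟨a, rfl⟩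
  | Sum.inr a => Or.inr ⟨a, rfl⟩

theorem alpha_injective : Function.Injective (alpha : Λ.Path → Λ.toeplitz.Path) :=
  Sum.inl_injective

theorem beta_injective : Function.Injective (beta : Λ.Path → Λ.toeplitz.Path) :=
  Sum.inr_injective

theorem alpha_ne_beta {a b : Λ.Path} : alpha a ≠ beta b := Sum.inl_ne_inr

theorem alphaV_injective : Function.Injective (alphaV : Λ.Vert → Λ.toeplitz.Vert) :=
  Sum.inl_injective

theorem betaV_injective : Function.Injective (betaV : Λ.Vert → Λ.toeplitz.Vert) :=
  Sum.inr_injective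

theorem alphaV_ne_betaV {x y : Λ.Vert} : alphaV x ≠ betaV y := Sum.inl_ne_inr

theorem r_beta {a : Λ.Path} (h : Λ.d a ≠ 0) : Λ.toeplitz.r (beta a) = alphaV (Λ.r a) := if_neg h

theorem r_beta_of_d_eq_zero {a : Λ.Path} (h : Λ.d a = 0) :
    Λ.toeplitz.r (beta a) = betaV (Λ.r a) :=
  if_pos h

theorem s_alpha (a : Λ.Path) : Λ.toeplitz.s (alpha a) = alphaV (Λ.s a) := rfl

theorem s_beta (a : Λ.Path) : Λ.toeplitz.s (beta a) = betaV (Λ.s a) := rfl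

theorem idn_alphaV (x : Λ.Vert) : Λ.toeplitz.idn (alphaV x) = alpha (Λ.idn x) := rfl

theorem idn_betaV (x : Λ.Vert) : Λ.toeplitz.idn (betaV x) = beta (Λ.idn x) := rfl

theorem s_alpha_eq_r_alpha {a b : Λ.Path} :
    Λ.toeplitz.s (alpha a) = Λ.toeplitz.r (alpha b) ↔ Λ.s a = Λ.r b :=
  alphaV_injective.eq_iff

theorem s_alpha_eq_r_beta {a b : Λ.Path} :
    Λ.toeplitz.s (alpha a) = Λ.toeplitz.r (beta b) ↔ Λ.s a = Λ.r b ∧ Λ.d b ≠ 0 := by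
  rw [s_alpha]
  by_cases h : Λ.d b = 0
  · rw [r_beta_of_d_eq_zero h]
    simp [alphaV_ne_betaV, h]
  · rw [r_beta h, alphaV_injective.eq_iff]
    simp [h]

theorem s_beta_ne_r_alpha {a b : Λ.Path} : Λ.toeplitz.s (beta a) ≠ Λ.toeplitz.r (alpha b) :=
  alphaV_ne_betaV.symm

theorem s_beta_eq_r_beta {a b : Λ.Path} :
    Λ.toeplitz.s (beta a) = Λ.toeplitz.r (beta b) ↔ Λ.s a = Λ.r b ∧ Λ.d b = 0 := by
  rw [s_beta]
  by_cases h : Λ.d b = 0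
  · rw [r_beta_of_d_eq_zero h, betaV_injective.eq_iff]
    simp [h]
  · rw [r_beta h]
    simp [alphaV_ne_betaV.symm, h]

theorem comp_alpha_alpha {a b : Λ.Path} (h : Λ.toeplitz.s (alpha a) = Λ.toeplitz.r (alpha b)) :
    Λ.toeplitz.comp (alpha a) (alpha b) h = alpha (Λ.comp a b (s_alpha_eq_r_alpha.1 h)) := rfl

theorem comp_alpha_beta {a b : Λ.Path} (h : Λ.toeplitz.s (alpha a) = Λ.toeplitz.r (beta b)) :
    Λ.toeplitz.comp (alpha a) (beta b) h = beta (Λ.comp a b (s_alpha_eq_r_beta.1 h).1) := rfl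

theorem comp_beta {a : Λ.Path} {τ : Λ.toeplitz.Path} (h : Λ.toeplitz.s (beta a) = Λ.toeplitz.r τ) :
    Λ.toeplitz.comp (beta a) τ h = beta a := rfl

theorem isInitial_alpha_alpha {a b : Λ.Path} :
    Λ.toeplitz.IsInitial (alpha a) (alpha b) ↔ Λ.IsInitial a b := by
  constructor
  · rintro ⟨τ, h, hc⟩
    obtain ⟨c, rfl⟩ | ⟨c, rfl⟩ := toeplitz_cases τ
    · exact ⟨c, _, alpha_injective hc⟩
    · exact (alpha_ne_beta hc.symm).elim
  · rintro ⟨c, h, rfl⟩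
    exact ⟨alpha c, s_alpha_eq_r_alpha.2 h, rfl⟩

theorem isInitial_alpha_beta {a b : Λ.Path} :
    Λ.toeplitz.IsInitial (alpha a) (beta b) ↔
      ∃ (c : Λ.Path) (h : Λ.s a = Λ.r c), Λ.d c ≠ 0 ∧ Λ.comp a c h = b := by
  constructor
  · rintro ⟨τ, h, hc⟩
    obtain ⟨c, rfl⟩ | ⟨c, rfl⟩ := toeplitz_cases τ
    · exact (alpha_ne_beta hc).elim
    · exact ⟨c, (s_alpha_eq_r_beta.1 h).1, (s_alpha_eq_r_beta.1 h).2, beta_injective hc⟩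
  · rintro ⟨c, h, hc0, rfl⟩
    exact ⟨beta c, s_alpha_eq_r_beta.2 ⟨h, hc0⟩, rfl⟩

/-- A path `β(a)` has no proper extension. -/
theorem isInitial_beta {a : Λ.Path} {τ : Λ.toeplitz.Path} :
    Λ.toeplitz.IsInitial (beta a) τ ↔ τ = beta a := by
  constructor
  · rintro ⟨b, h, rfl⟩
    rfl
  · rintro rfl
    exact ⟨_, _, Λ.toeplitz.comp_idn _⟩

section Family

variable {A : Type w} [NonUnitalRing A] (hΛ : Λ.RowFinite) (T Tstar : Λ.Path → A)

theorem toeplitzPath_alpha (a : Λ.Path) :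
    toeplitzPath hΛ T Tstar (alpha a) = T a * vertexRange hΛ T Tstar (Λ.s a) := rfl

theorem toeplitzPath_beta (a : Λ.Path) : toeplitzPath hΛ T Tstar (beta a) =
    T a * (T (Λ.idn (Λ.s a)) - vertexRange hΛ T Tstar (Λ.s a)) := rfl

theorem toeplitzGhost_alpha (a : Λ.Path) :
    toeplitzGhost hΛ T Tstar (alpha a) = vertexRange hΛ T Tstar (Λ.s a) * Tstar a := rfl

theorem toeplitzGhost_beta (a : Λ.Path) : toeplitzGhost hΛ T Tstar (beta a) =
    (T (Λ.idn (Λ.s a)) - vertexRange hΛ T Tstar (Λ.s a)) * Tstar a := rfl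

end Family

end Toeplitz

/-! ### The Kumjian–Pask family of `TΛ` in the Cohn path algebra of `Λ` -/

section ToeplitzFamily

variable (R : Type w) [CommRing R]

/-- The embedding `δ_a ↦ δ_{β(a)}`. -/
noncomputable def betaEmb : (Λ.Path →₀ R) →ₗ[R] (Λ.toeplitz.Path →₀ R) :=
  Finsupp.lmapDomain R R beta

theorem betaEmb_single (a : Λ.Path) :
    betaEmb R (Finsupp.single a 1) = Finsupp.single (beta a) 1 := by
  rw [betaEmb, Finsupp.lmapDomain_apply, Finsupp.mapDomain_single]

theorem betaEmb_injective : Function.Injective (betaEmb (Λ := Λ) R) :=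
  Finsupp.mapDomain_injective beta_injective

theorem pathRep_vertexRange (hΛ : Λ.RowFinite) (x : Λ.Vert) :
    CohnAlg.pathRep R hΛ (vertexRange hΛ (CohnAlg.path Λ R) (CohnAlg.ghost Λ R) x) =
      vertexRange hΛ (shift R) (backshift R) x := by
  have h := gapProd_intertwines (Λ := Λ) (R := R) (A := CohnAlg Λ R) (U := shift R)
    (Ustar := backshift R) (Φ := CohnAlg.pathRep R hΛ) (j := LinearMap.id)
    (S := CohnAlg.path Λ R) (Sstar := CohnAlg.ghost Λ R)
    (fun a m => congrArg (fun f => f m) (CohnAlg.pathRep_path R hΛ a))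
    (fun a m => congrArg (fun f => f m) (CohnAlg.pathRep_ghost R hΛ a)) x
    (hΛ.edgesAt_finite x).toFinset.toList
  rw [vertexRange, vertexRange, map_sub, CohnAlg.pathRep_path]
  exact congrArg _ (LinearMap.ext h)

theorem betaEmb_toeplitzPath (hΛ : Λ.RowFinite) (τ : Λ.toeplitz.Path) (m : Λ.Path →₀ R) :
    betaEmb R (CohnAlg.pathRep R hΛ
      (toeplitzPath hΛ (CohnAlg.path Λ R) (CohnAlg.ghost Λ R) τ) m) =
      shift R τ (betaEmb R m) := by
  refine LinearMap.congr_fun (f := (betaEmb R) ∘ₗ CohnAlg.pathRep R hΛ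
    (toeplitzPath hΛ (CohnAlg.path Λ R) (CohnAlg.ghost Λ R) τ)) (g := shift R τ ∘ₗ betaEmb R)
    (end_ext fun c => ?_) m
  classical
  rw [LinearMap.comp_apply, LinearMap.comp_apply, betaEmb_single]
  obtain ⟨a, rfl⟩ | ⟨a, rfl⟩ := toeplitz_cases τ
  · rw [toeplitzPath_alpha, map_mul, Module.End.mul_apply, pathRep_vertexRange,
      vertexRange_shift_single, CohnAlg.pathRep_path]
    by_cases h : Λ.r c = Λ.s a ∧ Λ.d c ≠ 0
    · have hc : Λ.toeplitz.s (alpha a) = Λ.toeplitz.r (beta c) :=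
        s_alpha_eq_r_beta.2 ⟨h.1.symm, h.2⟩
      rw [if_pos h, shift_single h.1.symm, betaEmb_single, shift_single hc]
      rfl
    · rw [if_neg h, map_zero, map_zero, shift_single_of_ne]
      exact fun hc => h ⟨(s_alpha_eq_r_beta.1 hc).1.symm, (s_alpha_eq_r_beta.1 hc).2⟩
  · rw [toeplitzPath_beta, map_mul, map_sub, Module.End.mul_apply, LinearMap.sub_apply,
      pathRep_vertexRange, vertexRange_shift_single, CohnAlg.pathRep_path, CohnAlg.pathRep_path]
    by_cases hr : Λ.r c = Λ.s a
    · rw [shift_idn_single hr]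
      by_cases hd : Λ.d c = 0
      · have hc : Λ.toeplitz.s (beta a) = Λ.toeplitz.r (beta c) :=
          s_beta_eq_r_beta.2 ⟨hr.symm, hd⟩
        rw [if_neg (fun h => h.2 hd), sub_zero, shift_single hr.symm, betaEmb_single,
          shift_single hc, comp_of_d_eq_zero _ hd]
        rfl
      · rw [if_pos ⟨hr, hd⟩, sub_self, map_zero, map_zero, shift_single_of_ne]
        exact fun hc => hd (s_beta_eq_r_beta.1 hc).2
    · rw [shift_idn_single_of_ne hr, if_neg (fun h => hr h.1), sub_zero, map_zero, map_zero,
        shift_single_of_ne]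
      exact fun hc => hr (s_beta_eq_r_beta.1 hc).1.symm

theorem betaEmb_toeplitzGhost (hΛ : Λ.RowFinite) (τ : Λ.toeplitz.Path) (m : Λ.Path →₀ R) :
    betaEmb R (CohnAlg.pathRep R hΛ
      (toeplitzGhost hΛ (CohnAlg.path Λ R) (CohnAlg.ghost Λ R) τ) m) =
      backshift R τ (betaEmb R m) := by
  refine LinearMap.congr_fun (f := (betaEmb R) ∘ₗ CohnAlg.pathRep R hΛ
    (toeplitzGhost hΛ (CohnAlg.path Λ R) (CohnAlg.ghost Λ R) τ)) (g := backshift R τ ∘ₗ betaEmb R)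
    (end_ext fun c => ?_) m
  classical
  rw [LinearMap.comp_apply, LinearMap.comp_apply, betaEmb_single]
  obtain ⟨a, rfl⟩ | ⟨a, rfl⟩ := toeplitz_cases τ
  · rw [toeplitzGhost_alpha, map_mul, Module.End.mul_apply, pathRep_vertexRange, CohnAlg.pathRep_ghost]
    by_cases hi : Λ.IsInitial a c
    · obtain ⟨b, h, rfl⟩ := hi
      rw [backshift_single, vertexRange_shift_single]
      by_cases hd : Λ.d b = 0
      · rw [if_neg (fun h => h.2 hd), map_zero, backshift_single_of_not]
        rw [isInitial_alpha_beta]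
        rintro ⟨b', h', hd', he⟩
        exact hd' (comp_left_cancel he ▸ hd)
      · have hc : Λ.toeplitz.s (alpha a) = Λ.toeplitz.r (beta b) :=
          s_alpha_eq_r_beta.2 ⟨h, hd⟩
        rw [if_pos ⟨h.symm, hd⟩, betaEmb_single]
        exact (backshift_single hc).symm
    · rw [backshift_single_of_not hi, map_zero, map_zero, backshift_single_of_not]
      rw [isInitial_alpha_beta]
      rintro ⟨b, h, -, he⟩
      exact hi ⟨b, h, he⟩
  · rw [toeplitzGhost_beta, map_mul, map_sub, Module.End.mul_apply, LinearMap.sub_apply,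
      pathRep_vertexRange, CohnAlg.pathRep_ghost, CohnAlg.pathRep_path]
    by_cases hi : Λ.IsInitial a c
    · obtain ⟨b, h, rfl⟩ := hi
      rw [backshift_single, vertexRange_shift_single, shift_idn_single h.symm]
      by_cases hd : Λ.d b = 0
      · obtain rfl : b = Λ.idn (Λ.s a) := by rw [h]; exact eq_idn_of_d_eq_zero hd
        have hc := backshift_single (R := R) (Λ.toeplitz.r_idn (Λ.toeplitz.s (beta a))).symm
        rw [Λ.toeplitz.comp_idn] at hc
        rw [if_neg (fun h => h.2 hd), sub_zero, betaEmb_single, comp_of_d_eq_zero _ hd, hc]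
        rfl
      · rw [if_pos ⟨h.symm, hd⟩, sub_self, map_zero, backshift_single_of_not]
        rw [isInitial_beta]
        intro he
        have hda := congrArg Λ.d (beta_injective he)
        rw [Λ.d_comp] at hda
        exact hd (left_eq_add.1 hda.symm)
    · rw [backshift_single_of_not hi, map_zero, map_zero, sub_zero, map_zero,
        backshift_single_of_not]
      rw [isInitial_beta]
      intro he
      exact hi ⟨_, _, (Λ.comp_idn a).trans (beta_injective he).symm⟩

/-- The elements `S_τ`, `S_{τ*}` form a Kumjian–Pask `TΛ`-family. For the gap relation: since
`β(a)` has no proper extension, an exhaustive set at its range contains an initial segment of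
`β(a)`, and the factor belonging to that member annihilates `δ_{β(a)}`. -/
theorem isKPFamily_toeplitz (hΛ : Λ.RowFinite) :
    IsKPFamily Λ.toeplitz (toeplitzPath hΛ (CohnAlg.path Λ R) (CohnAlg.ghost Λ R))
      (toeplitzGhost hΛ (CohnAlg.path Λ R) (CohnAlg.ghost Λ R)) := by
  let Φ : CohnAlg Λ R →ₙ+* Module.End R (Λ.Path →₀ R) := CohnAlg.pathRep R hΛ
  have hS : ∀ τ m, betaEmb R (Φ (toeplitzPath hΛ (CohnAlg.path Λ R) (CohnAlg.ghost Λ R) τ) m) =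
    shift R τ (betaEmb R m) := betaEmb_toeplitzPath R hΛ
  have hS' : ∀ τ m, betaEmb R (Φ (toeplitzGhost hΛ (CohnAlg.path Λ R) (CohnAlg.ghost Λ R) τ) m) =
    backshift R τ (betaEmb R m) := betaEmb_toeplitzGhost R hΛ
  refine ⟨IsCohnFamily.of_intertwines (Φ := Φ) hΛ.toeplitz
    (isCohnFamily_shift Λ.toeplitz R hΛ.toeplitz) (CohnAlg.pathRep_injective R hΛ)
    (betaEmb_injective R) hS hS', fun x l _ hE => ?_⟩
  refine CohnAlg.pathRep_injective R hΛ (end_ext fun c => betaEmb_injective R ?_)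
  refine (gapProd_intertwines (Φ := Φ) hS hS' x l _).trans ?_
  classical
  rw [betaEmb_single, gapProd_shift_single, if_neg, map_zero, LinearMap.zero_apply, map_zero]
  rintro ⟨hr, hl⟩
  obtain ⟨e, he, p, h, h', hp, -⟩ := hE.2 _ hr
  refine hl e he ⟨p.2, h', hp.symm⟩

end ToeplitzFamily

/-! ### Minimal common extensions in `TΛ` -/

section MinExt

theorem mem_minExt_iff {a b p q : Λ.Path} :
    (p, q) ∈ Λ.minExt a b ↔ ∃ (h : Λ.s a = Λ.r p) (h' : Λ.s b = Λ.r q),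
      Λ.comp a p h = Λ.comp b q h' ∧ Λ.d (Λ.comp a p h) = Λ.d a ⊔ Λ.d b := by
  constructor
  · rintro ⟨h, h', he, hd, -⟩
    exact ⟨h, h', he, hd⟩
  · rintro ⟨h, h', he, hd⟩
    exact ⟨h, h', he, hd, ⟨p, h, rfl⟩, ⟨q, h', he.symm⟩⟩

theorem minExt_nonempty_of_isInitial {a b : Λ.Path} (h : Λ.IsInitial a b) :
    (Λ.minExt a b).Nonempty := by
  have h' : Λ.IsInitial a (Λ.comp b (Λ.idn (Λ.s b)) (Λ.r_idn _).symm) := by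
    rwa [Λ.comp_idn]
  obtain ⟨p, hp, -⟩ := exists_minExt _ h'
  exact ⟨p, hp⟩

theorem minExt_nonempty_symm {a b : Λ.Path} (h : (Λ.minExt a b).Nonempty) :
    (Λ.minExt b a).Nonempty := by
  obtain ⟨⟨p, q⟩, hpq⟩ := h
  obtain ⟨h, h', he, hd⟩ := mem_minExt_iff.1 hpq
  exact ⟨(q, p), mem_minExt_iff.2 ⟨h', h, he.symm, by rw [← he, hd, sup_comm]⟩⟩

theorem comp_beta_beta {a b : Λ.Path} (h : Λ.toeplitz.s (beta a) = Λ.toeplitz.r (beta b)) :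
    Λ.toeplitz.comp (beta a) (beta b) h = beta (Λ.comp a b (s_beta_eq_r_beta.1 h).1) := by
  rw [comp_beta, comp_of_d_eq_zero _ (s_beta_eq_r_beta.1 h).2]

/-- A pair `(p, q) ∈ Λ^min(a, b)` always gives the pair `(α(p), α(q))` of minimal extensions of
`α(a)` and `α(b)`; the pair `(β(p), β(q))` arises from exactly one of the four choices of `α` or `β`
on `a` and on `b`, according to which of `p` and `q` are vertices. -/
theorem minExt_alpha_alpha (a b : Λ.Path) : Λ.toeplitz.minExt (alpha a) (alpha b) =
    Prod.map alpha alpha '' Λ.minExt a b ∪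
      Prod.map beta beta '' {p | p ∈ Λ.minExt a b ∧ Λ.d p.1 ≠ 0 ∧ Λ.d p.2 ≠ 0} := by
  ext ⟨τ, ω⟩
  constructor
  · intro hm
    obtain ⟨h, h', he, hd⟩ := mem_minExt_iff.1 hm
    obtain ⟨p, rfl⟩ | ⟨p, rfl⟩ := toeplitz_cases τ <;>
      obtain ⟨q, rfl⟩ | ⟨q, rfl⟩ := toeplitz_cases ω
    · exact Or.inl ⟨(p, q), mem_minExt_iff.2 ⟨_, _, alpha_injective he, hd⟩, rfl⟩
    · exact (alpha_ne_beta he).elim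
    · exact (alpha_ne_beta he.symm).elim
    · exact Or.inr ⟨(p, q), ⟨mem_minExt_iff.2 ⟨_, _, beta_injective he, hd⟩,
        (s_alpha_eq_r_beta.1 h).2, (s_alpha_eq_r_beta.1 h').2⟩, rfl⟩
  · rintro (⟨⟨p, q⟩, hpq, he⟩ | ⟨⟨p, q⟩, ⟨hpq, hp, hq⟩, he⟩) <;>
      obtain ⟨rfl, rfl⟩ := Prod.ext_iff.1 he <;>
      obtain ⟨h, h', he', hd⟩ := mem_minExt_iff.1 hpq
    · exact mem_minExt_iff.2 ⟨s_alpha_eq_r_alpha.2 h, s_alpha_eq_r_alpha.2 h',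
        congrArg alpha he', hd⟩
    · exact mem_minExt_iff.2 ⟨s_alpha_eq_r_beta.2 ⟨h, hp⟩, s_alpha_eq_r_beta.2 ⟨h', hq⟩,
        congrArg beta he', hd⟩

theorem minExt_alpha_beta (a b : Λ.Path) : Λ.toeplitz.minExt (alpha a) (beta b) =
    Prod.map beta beta '' {p | p ∈ Λ.minExt a b ∧ Λ.d p.1 ≠ 0 ∧ Λ.d p.2 = 0} := by
  ext ⟨τ, ω⟩
  constructor
  · intro hm
    obtain ⟨h, h', he, hd⟩ := mem_minExt_iff.1 hm
    obtain ⟨q, rfl⟩ | ⟨q, rfl⟩ := toeplitz_cases ω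
    · exact (s_beta_ne_r_alpha h').elim
    obtain ⟨p, rfl⟩ | ⟨p, rfl⟩ := toeplitz_cases τ
    · exact (alpha_ne_beta he).elim
    rw [comp_beta_beta, comp_alpha_beta] at he
    exact ⟨(p, q), ⟨mem_minExt_iff.2 ⟨_, _, beta_injective he, hd⟩,
      (s_alpha_eq_r_beta.1 h).2, (s_beta_eq_r_beta.1 h').2⟩, rfl⟩
  · rintro ⟨⟨p, q⟩, ⟨hpq, hp, hq⟩, he⟩
    obtain ⟨rfl, rfl⟩ := Prod.ext_iff.1 he
    obtain ⟨h, h', he', hd⟩ := mem_minExt_iff.1 hpq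
    refine mem_minExt_iff.2 ⟨s_alpha_eq_r_beta.2 ⟨h, hp⟩, s_beta_eq_r_beta.2 ⟨h', hq⟩, ?_, hd⟩
    simp only [Prod.map_fst, Prod.map_snd]
    rw [comp_beta_beta]
    exact congrArg beta he'

theorem minExt_beta_alpha (a b : Λ.Path) : Λ.toeplitz.minExt (beta a) (alpha b) =
    Prod.map beta beta '' {p | p ∈ Λ.minExt a b ∧ Λ.d p.1 = 0 ∧ Λ.d p.2 ≠ 0} := by
  ext ⟨τ, ω⟩
  constructor
  · intro hm
    obtain ⟨h, h', he, hd⟩ := mem_minExt_iff.1 hm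
    obtain ⟨p, rfl⟩ | ⟨p, rfl⟩ := toeplitz_cases τ
    · exact (s_beta_ne_r_alpha h).elim
    obtain ⟨q, rfl⟩ | ⟨q, rfl⟩ := toeplitz_cases ω
    · exact (alpha_ne_beta he.symm).elim
    rw [comp_beta_beta] at he hd
    exact ⟨(p, q), ⟨mem_minExt_iff.2 ⟨_, _, beta_injective he, hd⟩,
      (s_beta_eq_r_beta.1 h).2, (s_alpha_eq_r_beta.1 h').2⟩, rfl⟩
  · rintro ⟨⟨p, q⟩, ⟨hpq, hp, hq⟩, he⟩
    obtain ⟨rfl, rfl⟩ := Prod.ext_iff.1 he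
    obtain ⟨h, h', he', hd⟩ := mem_minExt_iff.1 hpq
    refine mem_minExt_iff.2 ⟨s_beta_eq_r_beta.2 ⟨h, hp⟩, s_alpha_eq_r_beta.2 ⟨h', hq⟩, ?_, ?_⟩ <;>
    simp only [Prod.map_fst, Prod.map_snd] <;> rw [comp_beta_beta]
    · exact congrArg beta he'
    · exact hd

theorem minExt_beta_beta (a b : Λ.Path) : Λ.toeplitz.minExt (beta a) (beta b) =
    Prod.map beta beta '' {p | p ∈ Λ.minExt a b ∧ Λ.d p.1 = 0 ∧ Λ.d p.2 = 0} := by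
  ext ⟨τ, ω⟩
  constructor
  · intro hm
    obtain ⟨h, h', he, hd⟩ := mem_minExt_iff.1 hm
    obtain ⟨p, rfl⟩ | ⟨p, rfl⟩ := toeplitz_cases τ
    · exact (s_beta_ne_r_alpha h).elim
    obtain ⟨q, rfl⟩ | ⟨q, rfl⟩ := toeplitz_cases ω
    · exact (s_beta_ne_r_alpha h').elim
    rw [comp_beta_beta] at hd
    rw [comp_beta_beta, comp_beta_beta] at he
    exact ⟨(p, q), ⟨mem_minExt_iff.2 ⟨_, _, beta_injective he, hd⟩,
      (s_beta_eq_r_beta.1 h).2, (s_beta_eq_r_beta.1 h').2⟩, rfl⟩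
  · rintro ⟨⟨p, q⟩, ⟨hpq, hp, hq⟩, he⟩
    obtain ⟨rfl, rfl⟩ := Prod.ext_iff.1 he
    obtain ⟨h, h', he', hd⟩ := mem_minExt_iff.1 hpq
    refine mem_minExt_iff.2 ⟨s_beta_eq_r_beta.2 ⟨h, hp⟩, s_beta_eq_r_beta.2 ⟨h', hq⟩, ?_, ?_⟩ <;>
    simp only [Prod.map_fst, Prod.map_snd] <;> rw [comp_beta_beta]
    · rw [comp_beta_beta]
      exact congrArg beta he'
    · exact hd

theorem finsum_mem_sep {ι A : Type*} [AddCommMonoid A] {s : Set ι} (hs : s.Finite)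
    (P : ι → Prop) [DecidablePred P] (f : ι → A) :
    ∑ᶠ p ∈ {p | p ∈ s ∧ P p}, f p = ∑ p ∈ hs.toFinset, if P p then f p else 0 := by
  rw [← Finset.sum_filter, ← finsum_mem_coe_finset]
  refine finsum_mem_congr ?_ fun _ _ => rfl
  ext p
  simp

end MinExt

/-! ### The Cohn family of `Λ` in the Kumjian–Pask algebra of `TΛ` -/

section CohnOfToeplitz

variable {A : Type w} [NonUnitalRing A] {S Sstar : Λ.toeplitz.Path → A}

/-- If `S` is a Cohn `TΛ`-family, then `T_a = S_{α(a)} + S_{β(a)}` is a Cohn `Λ`-family. -/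
theorem IsCohnFamily.of_toeplitz (hΛ : Λ.RowFinite) (hS : IsCohnFamily Λ.toeplitz S Sstar) :
    IsCohnFamily Λ (fun a => S (alpha a) + S (beta a))
      (fun a => Sstar (alpha a) + Sstar (beta a)) where
  ghost_idn x := by
    have h1 := hS.ghost_idn (alphaV x)
    have h2 := hS.ghost_idn (betaV x)
    rw [idn_alphaV] at h1
    rw [idn_betaV] at h2
    rw [h1, h2]
  idem x := by
    have h1 := hS.idem (alphaV x)
    have h2 := hS.idem (betaV x)
    have h3 := hS.orth _ _ (alphaV_ne_betaV (x := x) (y := x))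
    have h4 := hS.orth _ _ (alphaV_ne_betaV (x := x) (y := x)).symm
    simp only [idn_alphaV, idn_betaV] at h1 h2 h3 h4
    rw [add_mul, mul_add, mul_add, h1, h2, h3, h4, add_zero, zero_add]
  orth x y hxy := by
    have h1 := hS.orth _ _ (alphaV_injective.ne hxy)
    have h2 := hS.orth _ _ (betaV_injective.ne hxy)
    have h3 := hS.orth _ _ (alphaV_ne_betaV (x := x) (y := y))
    have h4 := hS.orth _ _ (alphaV_ne_betaV (x := y) (y := x)).symm
    simp only [idn_alphaV, idn_betaV] at h1 h2 h3 h4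
    rw [add_mul, mul_add, mul_add, h1, h2, h3, h4, add_zero, add_zero]
  mul_path a b h := by
    have h1 := hS.mul_path _ _ (s_alpha_eq_r_alpha.2 h)
    have h3 := hS.path_mul_path_of_ne (s_beta_ne_r_alpha (a := a) (b := b))
    rw [comp_alpha_alpha] at h1
    rw [add_mul, mul_add, mul_add, h1, h3, zero_add, add_assoc]
    congr 1
    by_cases hb : Λ.d b = 0
    · have h2 := hS.mul_path _ _ (s_beta_eq_r_beta.2 ⟨h, hb⟩)
      rw [comp_beta_beta] at h2
      rw [h2, hS.path_mul_path_of_ne (fun h' => (s_alpha_eq_r_beta.1 h').2 hb), zero_add]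
    · have h2 := hS.mul_path _ _ (s_alpha_eq_r_beta.2 ⟨h, hb⟩)
      rw [comp_alpha_beta] at h2
      rw [h2, hS.path_mul_path_of_ne (fun h' => hb (s_beta_eq_r_beta.1 h').2), add_zero]
  mul_ghost a b h := by
    have h1 := hS.mul_ghost _ _ (s_alpha_eq_r_alpha.2 h)
    have h3 := hS.ghost_mul_ghost_of_ne (s_beta_ne_r_alpha (a := a) (b := b))
    rw [comp_alpha_alpha] at h1
    rw [add_mul, mul_add, mul_add, h1, h3, add_zero]
    congr 1
    by_cases hb : Λ.d b = 0
    · have h2 := hS.mul_ghost _ _ (s_beta_eq_r_beta.2 ⟨h, hb⟩)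
      rw [comp_beta_beta] at h2
      rw [h2, hS.ghost_mul_ghost_of_ne (fun h' => (s_alpha_eq_r_beta.1 h').2 hb), zero_add]
    · have h2 := hS.mul_ghost _ _ (s_alpha_eq_r_beta.2 ⟨h, hb⟩)
      rw [comp_alpha_beta] at h2
      rw [h2, hS.ghost_mul_ghost_of_ne (fun h' => hb (s_beta_eq_r_beta.1 h').2), add_zero]
  ghost_mul_path a b := by
    classical
    have hfin := hΛ.minExt_finite a b
    have hfin' : ∀ P : Λ.Path × Λ.Path → Prop, {p | p ∈ Λ.minExt a b ∧ P p}.Finite := fun P =>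
      hfin.subset fun _ h => h.1
    have hα : Function.Injective (Prod.map alpha alpha : Λ.Path × Λ.Path → _) :=
      alpha_injective.prodMap alpha_injective
    have hβ : Function.Injective (Prod.map beta beta : Λ.Path × Λ.Path → _) :=
      beta_injective.prodMap beta_injective
    have hdisj : Disjoint (Prod.map alpha alpha '' Λ.minExt a b) (Prod.map beta beta ''
        {p | p ∈ Λ.minExt a b ∧ Λ.d p.1 ≠ 0 ∧ Λ.d p.2 ≠ 0}) := by
      rw [Set.disjoint_left]
      rintro _ ⟨p, -, rfl⟩ ⟨q, -, he⟩
      exact alpha_ne_beta (Prod.ext_iff.1 he).1.symm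
    rw [add_mul, mul_add, mul_add, hS.ghost_mul_path, hS.ghost_mul_path, hS.ghost_mul_path,
      hS.ghost_mul_path, minExt_alpha_alpha, minExt_alpha_beta, minExt_beta_alpha,
      minExt_beta_beta, finsum_mem_union hdisj (hfin.image _) ((hfin' _).image _),
      finsum_mem_image hα.injOn, finsum_mem_image hβ.injOn, finsum_mem_image hβ.injOn,
      finsum_mem_image hβ.injOn, finsum_mem_image hβ.injOn, finsum_mem_sep hfin,
      finsum_mem_sep hfin, finsum_mem_sep hfin, finsum_mem_sep hfin,
      finsum_mem_eq_finite_toFinset_sum _ hfin, finsum_mem_eq_finite_toFinset_sum _ hfin,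
      ← Finset.sum_add_distrib, ← Finset.sum_add_distrib, ← Finset.sum_add_distrib,
      ← Finset.sum_add_distrib]
    refine Finset.sum_congr rfl fun p _ => ?_
    have h1 : S (alpha p.1) * Sstar (beta p.2) = 0 :=
      hS.path_mul_ghost_of_ne (alphaV_ne_betaV (x := Λ.s p.1) (y := Λ.s p.2))
    have h2 : S (beta p.1) * Sstar (alpha p.2) = 0 :=
      hS.path_mul_ghost_of_ne (alphaV_ne_betaV (x := Λ.s p.2) (y := Λ.s p.1)).symm
    rw [add_mul, mul_add, mul_add, h1, h2]
    simp only [Prod.map_fst, Prod.map_snd]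
    by_cases hp : Λ.d p.1 = 0 <;> by_cases hq : Λ.d p.2 = 0 <;> simp [hp, hq]

/-- The vertex projection `S_{β(x)}` is orthogonal to the range projections of all edges at `α(x)`,
so it splits off from the gap product of `T_a = S_{α(a)} + S_{β(a)}`. What is left is the gap
product of `S` over the edges `α(e)`, `β(e)`, because the range projections of `α(e)` and `β(e)` are
orthogonal. -/
theorem gapProd_of_toeplitz (hS : IsCohnFamily Λ.toeplitz S Sstar) {x : Λ.Vert} {l : List Λ.Path}
    (hl : ∀ e ∈ l, e ∈ Λ.edgesAt x) :
    gapProd Λ (fun a => S (alpha a) + S (beta a)) (fun a => Sstar (alpha a) + Sstar (beta a)) x l =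
      S (beta (Λ.idn x)) +
        gapProd Λ.toeplitz S Sstar (alphaV x) (l.flatMap fun e => [alpha e, beta e]) := by
  induction l with
  | nil => exact add_comm _ _
  | cons e l ih =>
    have he := hl e (by simp)
    have hd := d_ne_zero_of_mem_edgesAt he
    have hrβ : Λ.toeplitz.r (beta e) = alphaV x := (r_beta hd).trans (congrArg alphaV he.1)
    have hrα : Λ.toeplitz.r (alpha e) = alphaV x := congrArg alphaV he.1
    have hrx : Λ.toeplitz.r (beta (Λ.idn x)) = betaV x :=
      (r_beta_of_d_eq_zero (Λ.d_idn x)).trans (congrArg betaV (Λ.r_idn x))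
    have hl' : ∀ e ∈ l, e ∈ Λ.edgesAt x := fun e he => hl e (List.mem_cons_of_mem _ he)
    have ih := ih hl'
    simp only [gapProd, List.flatMap_cons, List.foldr_cons, List.cons_append, List.nil_append]
      at ih ⊢
    rw [ih]
    have hG : S (alpha (Λ.idn x)) * gapProd Λ.toeplitz S Sstar (alphaV x)
        (l.flatMap fun e => [alpha e, beta e]) = gapProd Λ.toeplitz S Sstar (alphaV x)
        (l.flatMap fun e => [alpha e, beta e]) := by
      rw [← idn_alphaV]
      refine hS.idn_mul_gapProd fun τ hτ => ?_
      obtain ⟨f, hf, hτ⟩ := List.mem_flatMap.1 hτ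
      have hf' := hl' f hf
      simp only [List.mem_cons, List.not_mem_nil, or_false] at hτ
      rcases hτ with rfl | rfl
      · exact congrArg alphaV hf'.1
      · exact (r_beta (d_ne_zero_of_mem_edgesAt hf')).trans (congrArg alphaV hf'.1)
    rw [gapProd] at hG
    generalize List.foldr _ _ (l.flatMap fun e => [alpha e, beta e]) = G at hG ⊢
    rw [idn_alphaV]
    -- the rules that reduce every mixed product of the elements for `α(x)`, `β(x)`, `α(e)`, `β(e)`
    have z1 : S (alpha (Λ.idn x)) * S (beta (Λ.idn x)) = 0 := hS.orth _ _ alphaV_ne_betaV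
    have z2 : S (beta (Λ.idn x)) * S (beta (Λ.idn x)) = S (beta (Λ.idn x)) := hS.idem (betaV x)
    have z3 : S (beta (Λ.idn x)) * S (alpha (Λ.idn x)) = 0 := hS.orth _ _ alphaV_ne_betaV.symm
    have z4 : S (beta (Λ.idn x)) * G = 0 := by rw [← hG, ← mul_assoc, z3, zero_mul]
    have z5 : Sstar (alpha e) * S (beta (Λ.idn x)) = 0 :=
      hS.ghost_mul_path_of_ne (by rw [hrα, hrx]; exact alphaV_ne_betaV)
    have z6 : Sstar (beta e) * S (beta (Λ.idn x)) = 0 :=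
      hS.ghost_mul_path_of_ne (by rw [hrβ, hrx]; exact alphaV_ne_betaV)
    have z7 : S (alpha e) * Sstar (beta e) = 0 :=
      hS.path_mul_ghost_of_ne (alphaV_ne_betaV (x := Λ.s e) (y := Λ.s e))
    have z8 : S (beta e) * Sstar (alpha e) = 0 :=
      hS.path_mul_ghost_of_ne (alphaV_ne_betaV (x := Λ.s e) (y := Λ.s e)).symm
    have z9 : ∀ y, S (alpha (Λ.idn x)) * (S (beta e) * y) = S (beta e) * y := fun y => by
      rw [← mul_assoc, ← idn_alphaV, hS.idn_mul_path hrβ]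
    have z10 : ∀ y, Sstar (alpha e) * (S (beta e) * y) = 0 := fun y => by
      rw [← mul_assoc, hS.ghost_mul_path, minExt_alpha_beta]
      have : {p | p ∈ Λ.minExt e e ∧ Λ.d p.1 ≠ 0 ∧ Λ.d p.2 = 0} = ∅ := by
        refine Set.eq_empty_of_forall_notMem ?_
        rintro ⟨p, q⟩ ⟨⟨h, h', he, -⟩, hp, hq⟩
        exact hp (comp_left_cancel he ▸ hq)
      rw [this, Set.image_empty, finsum_mem_empty, zero_mul]
    rw [add_mul (S (alpha e)), mul_add (S (alpha e)), mul_add (S (beta e)), z7, z8]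
    simp only [add_mul, mul_add, sub_mul, mul_sub, mul_assoc, z1, z2, z4, z5, z6, z9, z10, hG,
      mul_zero, zero_mul]
    abel

/-- The edges `α(e)`, `β(e)` at `α(x)` form an exhaustive set. -/
theorem isExhaustive_toeplitz_edges (hk : 0 < k) (hsrc : Λ.NoSources) {x : Λ.Vert}
    {l : List Λ.Path} (hl : ∀ e, e ∈ l ↔ e ∈ Λ.edgesAt x) :
    Λ.toeplitz.IsExhaustive (alphaV x) {τ | τ ∈ l.flatMap fun e => [alpha e, beta e]} := by
  have hmem : ∀ τ, τ ∈ (l.flatMap fun e => [alpha e, beta e]) ↔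
      ∃ e ∈ Λ.edgesAt x, τ = alpha e ∨ τ = beta e := by
    intro τ
    simp [List.mem_flatMap, hl]
  constructor
  · intro τ hτ
    obtain ⟨e, he, rfl | rfl⟩ := (hmem τ).1 hτ
    · exact congrArg alphaV he.1
    · exact (r_beta (d_ne_zero_of_mem_edgesAt he)).trans (congrArg alphaV he.1)
  · intro τ hτ
    suffices H : ∃ ω, (∃ e ∈ Λ.edgesAt x, ω = alpha e ∨ ω = beta e) ∧
        (Λ.toeplitz.IsInitial τ ω ∨ Λ.toeplitz.IsInitial ω τ) by
      obtain ⟨ω, hω, hi⟩ := H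
      exact ⟨ω, (hmem ω).2 hω, hi.elim minExt_nonempty_of_isInitial fun h =>
        minExt_nonempty_symm (minExt_nonempty_of_isInitial h)⟩
    obtain ⟨c, rfl⟩ | ⟨c, rfl⟩ := toeplitz_cases τ
    · have hr : Λ.r c = x := alphaV_injective hτ
      subst hr
      by_cases hd : Λ.d c = 0
      · obtain ⟨e, he, hde⟩ := hsrc (Λ.r c) (Pi.single ⟨0, hk⟩ 1)
        refine ⟨alpha e, ⟨e, ⟨he, _, hde⟩, Or.inl rfl⟩, Or.inl (isInitial_alpha_alpha.2 ?_)⟩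
        rw [eq_idn_of_d_eq_zero hd]
        exact isInitial_idn_iff.2 he
      · obtain ⟨e, he, hi⟩ := exists_edge_isInitial hd
        exact ⟨alpha e, ⟨e, he, Or.inl rfl⟩, Or.inr (isInitial_alpha_alpha.2 hi)⟩
    · have hd : Λ.d c ≠ 0 := fun hd => alphaV_ne_betaV ((r_beta_of_d_eq_zero hd).symm.trans hτ).symm
      have hr : Λ.r c = x := alphaV_injective ((r_beta hd).symm.trans hτ)
      subst hr
      obtain ⟨e, he, b, h, hc⟩ := exists_edge_isInitial hd
      by_cases hb : Λ.d b = 0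
      · obtain rfl : e = c := (comp_of_d_eq_zero h hb).symm.trans hc
        exact ⟨beta e, ⟨e, he, Or.inr rfl⟩, Or.inl (isInitial_beta.2 rfl)⟩
      · exact ⟨alpha e, ⟨e, he, Or.inl rfl⟩, Or.inr (isInitial_alpha_beta.2 ⟨b, h, hb, hc⟩)⟩

/-- For a Kumjian–Pask `TΛ`-family `S`, the Cohn `Λ`-family `T_a = S_{α(a)} + S_{β(a)}` has
`F_{T,x} = S_{α(x)}`. -/
theorem vertexRange_of_toeplitz (hk : 0 < k) (hΛ : Λ.RowFinite) (hsrc : Λ.NoSources)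
    (hS : IsKPFamily Λ.toeplitz S Sstar) (x : Λ.Vert) :
    vertexRange hΛ (fun a => S (alpha a) + S (beta a)) (fun a => Sstar (alpha a) + Sstar (beta a))
      x = S (alpha (Λ.idn x)) := by
  have hl : ∀ e, e ∈ (hΛ.edgesAt_finite x).toFinset.toList ↔ e ∈ Λ.edgesAt x := fun e => by simp
  rw [vertexRange, gapProd_of_toeplitz hS.toIsCohnFamily fun e he => (hl e).1 he,
    hS.gap_eq_zero _ _ ?_ (isExhaustive_toeplitz_edges hk hsrc hl), add_zero, add_sub_cancel_right]
  refine List.nodup_flatMap.2 ⟨fun e _ => by simp [alpha_ne_beta], ?_⟩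
  refine (Finset.nodup_toList _).imp fun {e f} hef => ?_
  simp [Function.onFun, alpha_ne_beta, alpha_ne_beta.symm, alpha_injective.eq_iff,
    beta_injective.eq_iff, hef.symm]

theorem map_vertexRange {B : Type*} [NonUnitalRing B] (hΛ : Λ.RowFinite) (f : A →ₙ+* B)
    (T Tstar : Λ.Path → A) (x : Λ.Vert) : f (vertexRange hΛ T Tstar x) =
      vertexRange hΛ (fun a => f (T a)) (fun a => f (Tstar a)) x := by
  rw [vertexRange, map_sub, map_gapProd]
  rfl

end CohnOfToeplitz

end KGraph

theorem mainTheorem2 {k : ℕ} (hk : 0 < k) (Λ : KGraph.{u, v} k)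
    (hrow : Λ.RowFinite) (hsrc : Λ.NoSources) (R : Type w) [CommRing R] :
    (∃ π : KGraph.KPAlg Λ.toeplitz R →ₙₐ[R] KGraph.CohnAlg Λ R,
      (∀ τ : Λ.toeplitz.Path, π (KGraph.KPAlg.path Λ.toeplitz R τ) =
        KGraph.toeplitzPath hrow (KGraph.CohnAlg.path Λ R) (KGraph.CohnAlg.ghost Λ R) τ) ∧
      (∀ ω : Λ.toeplitz.Path, π (KGraph.KPAlg.ghost Λ.toeplitz R ω) =
        KGraph.toeplitzGhost hrow (KGraph.CohnAlg.path Λ R) (KGraph.CohnAlg.ghost Λ R) ω) ∧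
      Function.Bijective π) ∧
    (DirectSum.IsInternal (KGraph.CohnAlg.grade Λ R) ∧
      ∀ (m n : Fin k → ℤ), ∀ x ∈ KGraph.CohnAlg.grade Λ R m, ∀ y ∈ KGraph.CohnAlg.grade Λ R n,
        x * y ∈ KGraph.CohnAlg.grade Λ R (m + n)) := by
  refine ⟨?_, KGraph.CohnAlg.isInternal_grade R hrow,
    fun m n x hx y hy => KGraph.CohnAlg.grade_mul R hrow hx hy⟩
  have hT := KGraph.CohnAlg.isCohnFamily (Λ := Λ) R hrow
  have hS := KGraph.KPAlg.isKPFamily (Λ := Λ.toeplitz) R hrow.toeplitz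
  obtain ⟨π, ⟨hπ, hπ'⟩, -⟩ := KGraph.KPAlg.existsUnique_lift R hrow.toeplitz
    (KGraph.isKPFamily_toeplitz R hrow)
  obtain ⟨ρ, ⟨hρ, hρ'⟩, -⟩ := KGraph.CohnAlg.existsUnique_lift R hrow
    (KGraph.IsCohnFamily.of_toeplitz hrow hS.toIsCohnFamily)
  refine ⟨π, hπ, hπ', ?_⟩
  have hρF : ∀ x, ρ (KGraph.vertexRange hrow (KGraph.CohnAlg.path Λ R) (KGraph.CohnAlg.ghost Λ R) x)
      = KGraph.KPAlg.path Λ.toeplitz R (KGraph.alpha (Λ.idn x)) := by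
    intro x
    refine (KGraph.map_vertexRange hrow (ρ : KGraph.CohnAlg Λ R →ₙ+* KGraph.KPAlg Λ.toeplitz R) _ _ x).trans ?_
    rw [← KGraph.vertexRange_of_toeplitz hk hrow hsrc hS x]
    congr 1
    · exact funext hρ
    · exact funext hρ'
  have hπρ : π.comp ρ = NonUnitalAlgHom.id R _ := by
    refine (KGraph.CohnAlg.existsUnique_lift R hrow hT).unique ⟨fun a => ?_, fun a => ?_⟩
      ⟨fun a => rfl, fun a => rfl⟩
    · rw [NonUnitalAlgHom.comp_apply, hρ, map_add, hπ, hπ, KGraph.toeplitzPath_alpha,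
        KGraph.toeplitzPath_beta, ← mul_add, add_sub_cancel, hT.path_mul_idn rfl]
    · rw [NonUnitalAlgHom.comp_apply, hρ', map_add, hπ', hπ', KGraph.toeplitzGhost_alpha,
        KGraph.toeplitzGhost_beta, ← add_mul, add_sub_cancel, hT.idn_mul_ghost rfl]
  have hρπ : ρ.comp π = NonUnitalAlgHom.id R _ := by
    refine (KGraph.KPAlg.existsUnique_lift R hrow.toeplitz hS).unique ⟨fun τ => ?_, fun τ => ?_⟩
      ⟨fun τ => rfl, fun τ => rfl⟩ <;>
      obtain ⟨a, rfl⟩ | ⟨a, rfl⟩ := KGraph.toeplitz_cases τ <;>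
      rw [NonUnitalAlgHom.comp_apply]
    · rw [hπ, KGraph.toeplitzPath_alpha, map_mul, hρ, hρF, add_mul,
        hS.path_mul_path_of_ne KGraph.s_beta_ne_r_alpha, add_zero, ← KGraph.idn_alphaV,
        hS.path_mul_idn (KGraph.s_alpha a)]
    · rw [hπ, KGraph.toeplitzPath_beta, map_mul, map_sub, hρ, hρ, hρF, add_sub_cancel_left, add_mul,
        hS.path_mul_path_of_ne fun h => (KGraph.s_alpha_eq_r_beta.1 h).2 (Λ.d_idn _), zero_add,
        ← KGraph.idn_betaV, hS.path_mul_idn (KGraph.s_beta a)]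
    · have h0 : KGraph.KPAlg.path Λ.toeplitz R (KGraph.alpha (Λ.idn (Λ.s a))) *
          KGraph.KPAlg.ghost Λ.toeplitz R (KGraph.beta a) = 0 :=
        hS.path_mul_ghost_of_ne (by
          rw [KGraph.s_alpha, KGraph.s_beta]
          exact KGraph.alphaV_ne_betaV)
      rw [hπ', KGraph.toeplitzGhost_alpha, map_mul, hρ', hρF, mul_add, h0, add_zero,
        ← KGraph.idn_alphaV, hS.idn_mul_ghost (KGraph.s_alpha a)]
    · have h0 : KGraph.KPAlg.path Λ.toeplitz R (KGraph.beta (Λ.idn (Λ.s a))) *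
          KGraph.KPAlg.ghost Λ.toeplitz R (KGraph.alpha a) = 0 :=
        hS.path_mul_ghost_of_ne (by
          rw [KGraph.s_alpha, KGraph.s_beta]
          exact KGraph.alphaV_ne_betaV.symm)
      rw [hπ', KGraph.toeplitzGhost_beta, map_mul, map_sub, hρ, hρ', hρF, add_sub_cancel_left,
        mul_add, h0, zero_add, ← KGraph.idn_betaV, hS.idn_mul_ghost (KGraph.s_beta a)]
  exact Function.bijective_iff_has_inverse.2 ⟨ρ, DFunLike.congr_fun hρπ, DFunLike.congr_fun hπρ⟩
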